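/- For complex $x$, $q$ and integers $n\ge 0$ write $(x;q)_n=\prod_{i=0}^{n-1}(1-xq^i)$ and $(x_1,x_2;q)_n=(x_1;q)_n(x_2;q)_n$. For parameters $a\neq 0$, $k$, $q$, a pair of complex sequences $(\alpha_n(a,k,q),\beta_n(a,k,q))_{n\ge 0}$ is called a WP-Bailey pair if $\alpha_0(a,k,q)=\beta_0(a,k,q)=1$ and, for $n>0$, $$\beta_n(a,k,q)=\sum_{j=0}^{n}\frac{(k/a;q)_{n-j}(k;q)_{n+j}}{(q;q)_{n-j}(aq;q)_{n+j}}\,\alpha_j(a,k,q).$$ **Theorem.** Let $a,k,z,q\in\mathbb{C}$ with $|q|<1$, $a\ne 0$, $z\neq 0$, $kq^n\neq\pm1$ for all $n\ge 0$, and $aq^n\ne\pm 1$, $kq^n/z\neq\pm1$, $aq^n/z\ne\pm1$ for all $n\ge 1$ (so that no denominator below vanishes). Let $(\alpha_n,\beta_n)$ be a WP-Bailey pair at each of the parameter triples $(a,k,q)$, $(-a,-k,q)$, $(a^2,k^2,q^2)$, and suppose that the six series below converge absolutely. Then $$\sum_{n=1}^{\infty} \frac{(1-k q^{2n})(z;q)_{n}(q;q)_{n-1}}{(1-k)(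 q k,q k/z;q)_{n}}\left( \frac{q a}{ z }\right )^{n} \beta_n(a,k,q) +\sum_{n=1}^{\infty} \frac{(1+k q^{2n})(z;q)_{n}(q;q)_{n-1}}{(1+k)( -q k,-q k/z;q)_{n}}\left( \frac{-q a}{ z }\right )^{n}\beta_n(-a,-k,q)$$ $$-2 \sum_{n=1}^{\infty} \frac{(1-k^2q^{4n})(z^2;q^2)_{n}(q^2;q^2)_{n-1}} {(1-k^2)( q^2 k^2,q^2k^2/z^2;q^2)_{n}}\left( \frac{q^2 a^2}{ z^2 }\right )^{n}\beta_n(a^2,k^2,q^2)$$ $$=\sum_{n=1}^{\infty}\frac{(z;q)_{n}(q;q)_{n-1}}{(q a ,qa/z;q)_n}\left (\frac{q a}{z}\right)^{n}\alpha_n(a,k,q) +\sum_{n=1}^{\infty}\frac{(z;q)_{n}(q;q)_{n-1}}{(-q a ,-qa/z;q)_n}\left (\frac{-q a}{z}\right)^{n}\alpha_n(-a,-k,q)$$ $$-2\sum_{n=1}^{\infty}\frac{(z^2;q^2)_{n}(q^2;q^2)_{n-1}}{(q^2 a^2 ,q^2a^2/z^2;q^2)_n}\left (\frac{q^2a^2}{z^2}\right)^{n}\alpha_n(a^2,k^2,q^2).$$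 -/

import Mathlib

/-- The finite `q`-shifted factorial `(a; q)_n = (1 - a)(1 - a q) ⋯ (1 - a q ^ (n - 1))`. -/
noncomputable def qPoch (a q : ℂ) (n : ℕ) : ℂ :=
  ∏ i ∈ Finset.range n, (1 - a * q ^ i)

/-- The sequences `α`, `β` form a WP-Bailey pair at the parameters `(a, k, q)`. -/
def IsWPBaileyPair (a k q : ℂ) (α β : ℕ → ℂ) : Prop :=
  α 0 = 1 ∧ β 0 = 1 ∧
    ∀ n : ℕ, 0 < n →
      β n = ∑ j ∈ Finset.range (n + 1),
        qPoch (k / a) q (n - j) * qPoch k q (n + j) /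
          (qPoch q q (n - j) * qPoch (a * q) q (n + j)) * α j

/-- The `n`-th term (`n ≥ 1`) of the `β`-weighted series at the parameters `(a, k, z, q)`:
`(1 - k q^{2n}) (z; q)_n (q; q)_{n-1} / ((1 - k) (q k, q k / z; q)_n) (q a / z)^n β_n`. -/
noncomputable def betaTerm (a k z q : ℂ) (β : ℕ → ℂ) (n : ℕ) : ℂ :=
  (1 - k * q ^ (2 * n)) * qPoch z q n * qPoch q q (n - 1) /
    ((1 - k) * (qPoch (q * k) q n * qPoch (q * k / z) q n)) * (q * a / z) ^ n * β n

/-- The `n`-th term (`n ≥ 1`) of the `α`-weighted series at the parameters `(a, z, q)`: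
`(z; q)_n (q; q)_{n-1} / (q a, q a / z; q)_n (q a / z)^n α_n`. -/
noncomputable def alphaTerm (a z q : ℂ) (α : ℕ → ℂ) (n : ℕ) : ℂ :=
  qPoch z q n * qPoch q q (n - 1) /
    (qPoch (q * a) q n * qPoch (q * a / z) q n) * (q * a / z) ^ n * α n

open Filter Topology

/-! ### Finite and infinite `q`-shifted factorials -/

/-! For a single WP-Bailey pair, with w = 1/z, the β-series equals the α-series minus a combination
of Lambert series, `lambertDefect` (`tsum_betaTerm_eq`). Writing L(x; q) for the Lambert series,
u/(1-u) - u/(1+u) = 2u²/(1-u²) gives L(x; q) + L(-x; q) = 2 L(x²; q²). So the defects at (a, k, q),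
(-a, -k, q) and (a², k², q²) cancel in the stated combination.

To prove the single-pair identity, insert the definition of β_n and sum over n first. The
coefficient of α_j is then a very-well-poised ₆φ₅ series. For j > 0 it has the product value of
`one_add_sixPhiSum_pow`, which yields the α-series. For j = 0 the factor 1 - c, with c = 1, has been
divided out, and what remains is minus the Lambert defect (`sixPhiSum_one`). Both evaluations come
from one telescoping relation under a ↦ a q (`sixPhi_contiguous`), iterated until the parameter
tends to 0.

The interchange needs an absolutely convergent double series, which convergence of the two single
series does not provide. It does hold for small w, since the α-series at w₀ bounds the growth of α.
Multiplying by (kwq; q)_∞ (awq; q)_∞ removes the poles. Convergence at w₀ makes the cleared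
difference holomorphic in |w| < |w₀| and continuous up to the boundary, so its vanishing near 0
carries over to w₀ (`tsum_betaWeight_eq`). If w₀ is a power of q, the series terminate and the
interchange is immediate. -/

theorem qPoch_zero (x q : ℂ) : qPoch x q 0 = 1 := by simp [qPoch]

theorem qPoch_succ (x q : ℂ) (n : ℕ) : qPoch x q (n + 1) = qPoch x q n * (1 - x * q ^ n) := by
  simp [qPoch, Finset.prod_range_succ]

theorem qPoch_add (x q : ℂ) (m n : ℕ) :
    qPoch x q (m + n) = qPoch x q m * qPoch (x * q ^ m) q n := by
  simp only [qPoch, Finset.prod_range_add]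
  congr 1
  exact Finset.prod_congr rfl fun i _ => by ring

theorem qPoch_succ' (x q : ℂ) (n : ℕ) :
    qPoch x q (n + 1) = (1 - x) * qPoch (x * q) q n := by
  rw [add_comm, qPoch_add]; simp [qPoch]

theorem qPoch_ne_zero {x q : ℂ} (h : ∀ i, 1 - x * q ^ i ≠ 0) (n : ℕ) : qPoch x q n ≠ 0 :=
  Finset.prod_ne_zero_iff.2 fun i _ => h i

theorem one_sub_pow_ne_zero {q : ℂ} (hq : ‖q‖ < 1) (i : ℕ) : 1 - q * q ^ i ≠ 0 := by
  intro h
  have h1 : ‖q ^ (i + 1)‖ = 1 := by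
    rw [pow_succ', ← sub_eq_zero.1 h, norm_one]
  rw [norm_pow] at h1
  exact (pow_lt_one₀ (norm_nonneg q) hq (Nat.succ_ne_zero i)).ne h1

/-- Each factor is at most exp(R‖q‖^i), and these exponents form a geometric series. -/
theorem exists_norm_qPoch_le {q : ℂ} (hq : ‖q‖ < 1) (R : ℝ) :
    ∃ C > 0, ∀ x : ℂ, ‖x‖ ≤ R → ∀ n, ‖qPoch x q n‖ ≤ C := by
  refine ⟨Real.exp (R * (1 - ‖q‖)⁻¹), Real.exp_pos _, fun x hx n => ?_⟩
  have hR : 0 ≤ R := (norm_nonneg x).trans hx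
  calc ‖qPoch x q n‖ = ∏ i ∈ Finset.range n, ‖1 - x * q ^ i‖ := by simp [qPoch]
    _ ≤ ∏ i ∈ Finset.range n, Real.exp (R * ‖q‖ ^ i) := by
        refine Finset.prod_le_prod (fun _ _ => norm_nonneg _) fun i _ => ?_
        calc ‖1 - x * q ^ i‖ ≤ ‖(1 : ℂ)‖ + ‖x * q ^ i‖ := norm_sub_le _ _
          _ ≤ R * ‖q‖ ^ i + 1 := by
              rw [norm_one, norm_mul, norm_pow, add_comm]; gcongr
          _ ≤ _ := Real.add_one_le_exp _
    _ = Real.exp (R * ∑ i ∈ Finset.range n, ‖q‖ ^ i) := by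
        rw [← Real.exp_sum, Finset.mul_sum]
    _ ≤ _ := by
        gcongr
        rw [← tsum_geometric_of_lt_one (norm_nonneg q) hq]
        exact (summable_geometric_of_lt_one (norm_nonneg q) hq).sum_le_tsum _
          fun _ _ => by positivity

/-- The infinite `q`-shifted factorial `(x; q)_∞`. -/
noncomputable def qPochInf (x q : ℂ) : ℂ := ∏' n : ℕ, (1 - x * q ^ n)

theorem summable_norm_mul_pow {q : ℂ} (hq : ‖q‖ < 1) (x : ℂ) :
    Summable fun n : ℕ => ‖-(x * q ^ n)‖ := by
  simpa [norm_mul, norm_pow] using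
    (summable_geometric_of_lt_one (norm_nonneg q) hq).mul_left ‖x‖

theorem tendsto_qPoch {q : ℂ} (hq : ‖q‖ < 1) (x : ℂ) :
    Tendsto (qPoch x q) atTop (𝓝 (qPochInf x q)) := by
  have h := (multipliable_one_add_of_summable (summable_norm_mul_pow hq x)).hasProd.tendsto_prod_nat
  simp only [← sub_eq_add_neg] at h
  exact h

theorem qPochInf_ne_zero {x q : ℂ} (hq : ‖q‖ < 1) (h : ∀ i : ℕ, 1 - x * q ^ i ≠ 0) :
    qPochInf x q ≠ 0 := by
  have := tprod_one_add_ne_zero_of_summable (f := fun n : ℕ => -(x * q ^ n))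
    (fun i => by simpa only [← sub_eq_add_neg] using h i) (summable_norm_mul_pow hq x)
  simp only [← sub_eq_add_neg] at this
  exact this

theorem qPochInf_eq_mul {q : ℂ} (hq : ‖q‖ < 1) (x : ℂ) (n : ℕ) :
    qPochInf x q = qPoch x q n * qPochInf (x * q ^ n) q := by
  refine tendsto_nhds_unique ((tendsto_add_atTop_iff_nat n).2 (tendsto_qPoch hq x)) ?_
  refine ((tendsto_qPoch hq (x * q ^ n)).const_mul (qPoch x q n)).congr fun m => ?_
  rw [← qPoch_add, add_comm]

theorem exists_norm_qPochInf_le {q : ℂ} (hq : ‖q‖ < 1) (R : ℝ) :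
    ∃ C > 0, ∀ x : ℂ, ‖x‖ ≤ R → ‖qPochInf x q‖ ≤ C := by
  obtain ⟨C, hC, h⟩ := exists_norm_qPoch_le hq R
  exact ⟨C, hC, fun x hx => le_of_tendsto (tendsto_qPoch hq x).norm (Eventually.of_forall (h x hx))⟩

theorem norm_mul_pow_le {q : ℂ} (hq : ‖q‖ < 1) (x : ℂ) (n : ℕ) : ‖x * q ^ n‖ ≤ ‖x‖ := by
  rw [norm_mul, norm_pow]
  exact mul_le_of_le_one_right (norm_nonneg x) (pow_le_one₀ (norm_nonneg q) hq.le)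

/-- Since 1/(xq^n)_∞ = (x)_n/(x)_∞, an upper bound for finite products suffices. -/
theorem exists_norm_inv_qPochInf_le {x q : ℂ} (hq : ‖q‖ < 1) (h : ∀ i : ℕ, 1 - x * q ^ i ≠ 0) :
    ∃ C > 0, ∀ n : ℕ, ‖(qPochInf (x * q ^ n) q)⁻¹‖ ≤ C := by
  obtain ⟨C, hC, hb⟩ := exists_norm_qPoch_le hq ‖x‖
  have hP := qPochInf_ne_zero hq h
  refine ⟨C * ‖(qPochInf x q)⁻¹‖, mul_pos hC (norm_pos_iff.2 (inv_ne_zero hP)), fun n => ?_⟩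
  have e : (qPochInf (x * q ^ n) q)⁻¹ = qPoch x q n * (qPochInf x q)⁻¹ := by
    rw [qPochInf_eq_mul hq x n, mul_inv, mul_inv_cancel_left₀ (qPoch_ne_zero h n)]
  rw [e, norm_mul]
  gcongr
  exact hb x le_rfl n

/-- Follows from 1/(xq^n)_m = (xq^(n+m))_∞/(xq^n)_∞. Uniformity in n is needed for the iterated
shift a ↦ a q^n. -/
theorem exists_norm_inv_qPoch_le {x q : ℂ} (hq : ‖q‖ < 1) (h : ∀ i : ℕ, 1 - x * q ^ i ≠ 0) :
    ∃ C > 0, ∀ n m : ℕ, ‖(qPoch (x * q ^ n) q m)⁻¹‖ ≤ C := by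
  obtain ⟨C, hC, hb⟩ := exists_norm_qPochInf_le hq ‖x‖
  obtain ⟨D, hD, hd⟩ := exists_norm_inv_qPochInf_le hq h
  refine ⟨C * D, by positivity, fun n m => ?_⟩
  have h1 : ∀ n, qPochInf (x * q ^ n) q ≠ 0 := fun n =>
    qPochInf_ne_zero hq fun i => by simpa only [mul_assoc, ← pow_add] using h (n + i)
  have e : (qPoch (x * q ^ n) q m)⁻¹ =
      qPochInf (x * q ^ (n + m)) q * (qPochInf (x * q ^ n) q)⁻¹ := by
    rw [qPochInf_eq_mul hq (x * q ^ n) m, mul_assoc x, ← pow_add, mul_inv_rev,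
      mul_inv_cancel_left₀ (h1 _)]
  rw [e, norm_mul]
  gcongr
  · exact hb _ (norm_mul_pow_le hq x _)
  · exact hd n

theorem multipliableLocallyUniformlyOn_qPochInf {q : ℂ} (hq : ‖q‖ < 1) (R : ℝ) :
    MultipliableLocallyUniformlyOn (fun (n : ℕ) (x : ℂ) => 1 - x * q ^ n) (Metric.ball 0 R) := by
  have h := Summable.multipliableLocallyUniformlyOn_nat_one_add
    (f := fun (n : ℕ) (x : ℂ) => -(x * q ^ n)) (K := Metric.ball 0 R) Metric.isOpen_ball
    ((summable_geometric_of_lt_one (norm_nonneg q) hq).mul_left R)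
    (Eventually.of_forall fun n x hx => by
      rw [norm_neg, norm_mul, norm_pow]
      have : ‖x‖ ≤ R := (mem_ball_zero_iff.1 hx).le
      gcongr) (fun n => by fun_prop)
  simpa only [← sub_eq_add_neg] using h

theorem differentiable_qPochInf {q : ℂ} (hq : ‖q‖ < 1) :
    Differentiable ℂ fun x => qPochInf x q := by
  intro x
  have hd : DifferentiableOn ℂ (fun x => qPochInf x q) (Metric.ball 0 (‖x‖ + 1)) :=
    (multipliableLocallyUniformlyOn_qPochInf hq (‖x‖ + 1)).hasProdLocallyUniformlyOn.differentiableOn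
      (.of_forall fun _ => by
        simpa [Finset.prod_fn] using DifferentiableOn.finsetProd (fun _ _ => by fun_prop))
      Metric.isOpen_ball
  exact hd.differentiableAt (Metric.isOpen_ball.mem_nhds (by simp))

/-! ### Lambert series -/

/-- The Lambert series `∑ x q ^ n / (1 - x q ^ n)`. -/
noncomputable def lambert (x q : ℂ) : ℂ := ∑' n : ℕ, x * q ^ n / (1 - x * q ^ n)

theorem exists_norm_inv_one_sub_le {x q : ℂ} (hq : ‖q‖ < 1) (h : ∀ i : ℕ, 1 - x * q ^ i ≠ 0) :
    ∃ C > 0, ∀ n : ℕ, ‖(1 - x * q ^ n)⁻¹‖ ≤ C := by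
  obtain ⟨C, hC, hb⟩ := exists_norm_inv_qPoch_le hq h
  exact ⟨C, hC, fun n => by simpa [qPoch] using hb n 1⟩

theorem summable_lambert {x q : ℂ} (hq : ‖q‖ < 1) (h : ∀ i : ℕ, 1 - x * q ^ i ≠ 0) :
    Summable fun n : ℕ => x * q ^ n / (1 - x * q ^ n) := by
  obtain ⟨C, hC, hb⟩ := exists_norm_inv_one_sub_le hq h
  refine Summable.of_norm_bounded ((summable_norm_mul_pow hq x).mul_right C) fun n => ?_
  rw [div_eq_mul_inv, norm_mul, norm_neg]
  gcongr
  exact hb n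

theorem lambert_eq_sum_add {x q : ℂ} (hq : ‖q‖ < 1) (h : ∀ i : ℕ, 1 - x * q ^ i ≠ 0) (n : ℕ) :
    lambert x q = ∑ i ∈ Finset.range n, x * q ^ i / (1 - x * q ^ i) + lambert (x * q ^ n) q := by
  rw [lambert, ← (summable_lambert hq h).sum_add_tsum_nat_add n, lambert]
  congr 1
  refine tsum_congr fun i => ?_
  rw [add_comm i n, pow_add, mul_assoc]

theorem lambert_eq_add {x q : ℂ} (hq : ‖q‖ < 1) (h : ∀ i : ℕ, 1 - x * q ^ i ≠ 0) :
    lambert x q = x / (1 - x) + lambert (x * q) q := by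
  simpa using lambert_eq_sum_add hq h 1

theorem tendsto_lambert {x q : ℂ} (hq : ‖q‖ < 1) (h : ∀ i : ℕ, 1 - x * q ^ i ≠ 0) :
    Tendsto (fun n : ℕ => lambert (x * q ^ n) q) atTop (𝓝 0) := by
  have h1 := (summable_lambert hq h).hasSum.tendsto_sum_nat
  have h2 := h1.const_sub (lambert x q)
  rw [← lambert, sub_self] at h2
  exact h2.congr fun n => by rw [lambert_eq_sum_add hq h n, add_sub_cancel_left]

theorem lambert_add_lambert_neg {x q : ℂ} (hq : ‖q‖ < 1)
    (h : ∀ i : ℕ, 1 - x * q ^ i ≠ 0 ∧ 1 + x * q ^ i ≠ 0) :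
    lambert x q + lambert (-x) q = 2 * lambert (x ^ 2) (q ^ 2) := by
  have h' : ∀ i : ℕ, 1 - -x * q ^ i ≠ 0 := fun i => by simpa using (h i).2
  rw [lambert, lambert, lambert, ← tsum_mul_left,
    ← (summable_lambert hq fun i => (h i).1).tsum_add (summable_lambert hq h')]
  refine tsum_congr fun n => ?_
  have e : 1 - x ^ 2 * (q ^ 2) ^ n = (1 - x * q ^ n) * (1 + x * q ^ n) := by ring
  have h1 := (h n).1
  have h2 := (h n).2
  have h3 := h' n
  rw [e, show 1 - -x * q ^ n = 1 + x * q ^ n by ring]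
  field_simp
  ring

/-- Logarithmic differentiation of the product. The left side is entire in x, so it replaces the
Lambert series once the poles are cleared. -/
theorem neg_mul_deriv_qPochInf {x q : ℂ} (hq : ‖q‖ < 1) (h : ∀ i : ℕ, 1 - x * q ^ i ≠ 0) :
    -x * deriv (fun y => qPochInf y q) x = qPochInf x q * lambert x q := by
  have hP := qPochInf_ne_zero hq h
  have hl : ∀ n : ℕ, logDeriv (fun y : ℂ => 1 - y * q ^ n) x = -q ^ n * (1 - x * q ^ n)⁻¹ := by
    intro n
    have : HasDerivAt (fun y : ℂ => 1 - y * q ^ n) (-(1 * q ^ n)) x :=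
      ((hasDerivAt_id x).mul_const (q ^ n)).const_sub 1
    rw [logDeriv_apply, this.deriv]; ring
  obtain ⟨C, hC, hb⟩ := exists_norm_inv_one_sub_le hq h
  have hs : Summable fun n : ℕ => logDeriv (fun y : ℂ => 1 - y * q ^ n) x := by
    simp only [hl]
    refine Summable.of_norm_bounded
      ((summable_geometric_of_lt_one (norm_nonneg q) hq).mul_right C) fun n => ?_
    rw [norm_mul, norm_neg, norm_pow]
    gcongr
    exact hb n
  have key := logDeriv_tprod_eq_tsum (s := Metric.ball (0 : ℂ) (‖x‖ + 1)) Metric.isOpen_ball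
    (x := x) (by simp) (f := fun (n : ℕ) y => 1 - y * q ^ n) h (fun n => by fun_prop) hs
    (multipliableLocallyUniformlyOn_qPochInf hq _) hP
  change logDeriv (fun y => qPochInf y q) x = _ at key
  rw [logDeriv_apply, div_eq_iff hP] at key
  rw [key, lambert, ← mul_assoc, ← tsum_mul_left, mul_comm]
  congr 1
  refine tsum_congr fun n => ?_
  rw [hl]; ring

/-! ### The polynomials `∏ (w - q ^ i)` -/

/-- The polynomial `∏ i < n, (w - q ^ i)`, which is `w ^ n (1 / w; q)_n` for `w ≠ 0`. -/
noncomputable def revPoch (w q : ℂ) (n : ℕ) : ℂ := ∏ i ∈ Finset.range n, (w - q ^ i)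

theorem revPoch_succ (w q : ℂ) (n : ℕ) : revPoch w q (n + 1) = revPoch w q n * (w - q ^ n) :=
  Finset.prod_range_succ _ _

theorem revPoch_eq {z : ℂ} (hz : z ≠ 0) (q : ℂ) (n : ℕ) :
    revPoch z⁻¹ q n = qPoch z q n * (z⁻¹) ^ n := by
  rw [revPoch, qPoch, ← Finset.card_range n, ← Finset.prod_const, Finset.card_range,
    ← Finset.prod_mul_distrib]
  refine Finset.prod_congr rfl fun i _ => ?_
  field_simp

/-- Taking r out of each factor leaves 1 + ‖q‖^i/r, whose product converges. -/
theorem exists_norm_revPoch_le {q : ℂ} (hq : ‖q‖ < 1) {r : ℝ} (hr : 0 < r) :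
    ∃ C > 0, ∀ w : ℂ, ‖w‖ ≤ r → ∀ n, ‖revPoch w q n‖ ≤ C * r ^ n := by
  refine ⟨Real.exp (r⁻¹ * (1 - ‖q‖)⁻¹), Real.exp_pos _, fun w hw n => ?_⟩
  calc ‖revPoch w q n‖ = ∏ i ∈ Finset.range n, ‖w - q ^ i‖ := by simp [revPoch]
    _ ≤ ∏ i ∈ Finset.range n, (Real.exp (r⁻¹ * ‖q‖ ^ i) * r) := by
        refine Finset.prod_le_prod (fun _ _ => norm_nonneg _) fun i _ => ?_
        calc ‖w - q ^ i‖ ≤ ‖w‖ + ‖q ^ i‖ := norm_sub_le _ _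
          _ ≤ r + ‖q‖ ^ i := by rw [norm_pow]; gcongr
          _ = (r⁻¹ * ‖q‖ ^ i + 1) * r := by field_simp; ring
          _ ≤ _ := by gcongr; exact Real.add_one_le_exp _
    _ = Real.exp (r⁻¹ * ∑ i ∈ Finset.range n, ‖q‖ ^ i) * r ^ n := by
        rw [Finset.prod_mul_distrib, ← Real.exp_sum, Finset.mul_sum]; simp
    _ ≤ _ := by
        gcongr
        rw [← tsum_geometric_of_lt_one (norm_nonneg q) hq]
        exact (summable_geometric_of_lt_one (norm_nonneg q) hq).sum_le_tsum _
          fun _ _ => by positivity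

/-! ### A very-well-poised `₆φ₅` sum -/

theorem qPoch_mul_shift (x q : ℂ) (n : ℕ) :
    qPoch (x * q) q n * (1 - x) = qPoch x q n * (1 - x * q ^ n) := by
  rw [mul_comm, ← qPoch_succ', qPoch_succ]

/-- The summand of the `₆φ₅` series with parameters `d a, 1 / e, c, d`, at the index `m + 1`, without
the well-poised factor `1 - d a q ^ (2 m + 2)` and without the factor `1 - c`. -/
noncomputable def sixPhiCore (d e c q a : ℂ) (m : ℕ) : ℂ :=
  qPoch (d * a * q) q m * revPoch e q (m + 1) * qPoch (c * q) q m * qPoch d q (m + 1) *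
    (qPoch q q (m + 1))⁻¹ * (qPoch (d * a * e * q) q (m + 1))⁻¹ *
    (qPoch (d * a / c * q) q (m + 1))⁻¹ * (qPoch (a * q) q (m + 1))⁻¹ * (a * q / c) ^ (m + 1)

/-- The summand of the `₆φ₅` series at the index `m + 1`, without the factor `1 - c`. -/
noncomputable def sixPhiTerm (d e c q a : ℂ) (m : ℕ) : ℂ :=
  (1 - d * a * q ^ (2 * (m + 1))) * sixPhiCore d e c q a m

/-- The telescoping companion of `sixPhiTerm` under `a ↦ a q`. -/
noncomputable def sixPhiCert (d e c q a : ℂ) (m : ℕ) : ℂ :=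
  (1 - q ^ (m + 1)) * (1 - d * a * (a * q * e / c) * q ^ (m + 1)) * sixPhiCore d e c q a m

/-- The multiplier of the contiguous relation of the `₆φ₅` series under `a ↦ a q`. -/
noncomputable def sixPhiRatio (d e c q a : ℂ) : ℂ :=
  (1 - d * a * q) * (1 - d * a * q * e / c) * (1 - a * q * e) * (1 - a * q / c) /
    ((1 - d * a * e * q) * (1 - d * a / c * q) * (1 - a * q))

theorem inv_qPoch_shift {x q : ℂ} (h : ∀ i, 1 - x * q * q ^ i ≠ 0) (n : ℕ) :
    (qPoch (x * q * q) q n)⁻¹ =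
      (qPoch (x * q) q n)⁻¹ * (1 - x * q) / (1 - x * q * q ^ n) := by
  have h1 : ∀ i, 1 - x * q * q * q ^ i ≠ 0 := fun i => by
    simpa only [pow_succ', mul_assoc] using h (i + 1)
  have h2 := qPoch_mul_shift (x * q) q n
  have h3 := qPoch_ne_zero h n
  have h4 := qPoch_ne_zero h1 n
  rw [eq_div_iff (h n), inv_mul_eq_div, inv_mul_eq_div, div_eq_div_iff h4 h3]
  linear_combination -h2

theorem sixPhiCore_shift {d e c q a : ℂ}
    (h0 : ∀ i : ℕ, 1 - d * a * q * q ^ i ≠ 0)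
    (h1 : ∀ i : ℕ, 1 - d * a * e * q * q ^ i ≠ 0) (h2 : ∀ i : ℕ, 1 - d * a / c * q * q ^ i ≠ 0)
    (h3 : ∀ i : ℕ, 1 - a * q * q ^ i ≠ 0) (m : ℕ) :
    sixPhiCore d e c q (a * q) m = sixPhiCore d e c q a m *
      (q ^ (m + 1) * (1 - d * a * q * q ^ m) * (1 - d * a * e * q) * (1 - d * a / c * q) *
        (1 - a * q) / ((1 - d * a * q) * (1 - d * a * e * q * q ^ (m + 1)) *
        (1 - d * a / c * q * q ^ (m + 1)) * (1 - a * q * q ^ (m + 1)))) := by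
  have hd : 1 - d * a * q ≠ 0 := by simpa using h0 0
  have e0 : qPoch (d * a * q * q) q m = qPoch (d * a * q) q m * (1 - d * a * q * q ^ m) /
      (1 - d * a * q) := by
    rw [eq_div_iff hd, qPoch_mul_shift]
  have e1 := inv_qPoch_shift h1 (m + 1)
  have e2 := inv_qPoch_shift h2 (m + 1)
  have e3 := inv_qPoch_shift h3 (m + 1)
  rw [sixPhiCore, show d * (a * q) * q = d * a * q * q by ring,
    show d * (a * q) * e * q = d * a * e * q * q by ring,
    show d * (a * q) / c * q = d * a / c * q * q by ring, e0, e1, e2, e3, sixPhiCore,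
    show a * q * q / c = a * q / c * q by ring, mul_pow (a * q / c)]
  simp only [div_eq_mul_inv, mul_inv]
  ring

theorem sixPhiCore_succ {q : ℂ} (d e c a : ℂ) (m : ℕ) :
    sixPhiCore d e c q a (m + 1) = sixPhiCore d e c q a m *
      ((1 - d * a * q * q ^ m) * (e - q ^ (m + 1)) * (1 - c * q * q ^ m) * (1 - d * q ^ (m + 1)) *
        (a * q / c) / ((1 - q * q ^ (m + 1)) * (1 - d * a * e * q * q ^ (m + 1)) *
        (1 - d * a / c * q * q ^ (m + 1)) * (1 - a * q * q ^ (m + 1)))) := by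
  rw [sixPhiCore, sixPhiCore, qPoch_succ _ _ m, revPoch_succ _ _ (m + 1), qPoch_succ (c * q) _ m,
    qPoch_succ d, qPoch_succ q, qPoch_succ (d * a * e * q), qPoch_succ (d * a / c * q),
    qPoch_succ (a * q), pow_succ (a * q / c)]
  simp only [div_eq_mul_inv, mul_inv]
  ring

/-- A Wilf–Zeilberger certificate: all four terms are rational multiples of the same core term, so
the claim is a polynomial identity in q^(m+1) after clearing denominators. -/
theorem sixPhi_contiguous {d e c q a : ℂ} (hq : ‖q‖ < 1) (hc : c ≠ 0)
    (h0 : ∀ i : ℕ, 1 - d * a * q * q ^ i ≠ 0)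
    (h1 : ∀ i : ℕ, 1 - d * a * e * q * q ^ i ≠ 0) (h2 : ∀ i : ℕ, 1 - d * a / c * q * q ^ i ≠ 0)
    (h3 : ∀ i : ℕ, 1 - a * q * q ^ i ≠ 0) (m : ℕ) :
    (1 - a * q * e / c) * sixPhiTerm d e c q a m -
      sixPhiRatio d e c q a * sixPhiTerm d e c q (a * q) m =
      sixPhiCert d e c q a m - sixPhiCert d e c q a (m + 1) := by
  have hd0 : 1 - d * a * q ≠ 0 := by simpa using h0 0
  have hd1 : 1 - d * a * e * q ≠ 0 := by simpa using h1 0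
  have hd2 : 1 - d * a / c * q ≠ 0 := by simpa using h2 0
  have hd3 : 1 - a * q ≠ 0 := by simpa using h3 0
  have hq1 : 1 - q * q ^ (m + 1) ≠ 0 := one_sub_pow_ne_zero hq _
  have k1 := h1 (m + 1)
  have k2 := h2 (m + 1)
  have k3 := h3 (m + 1)
  rw [sixPhiTerm, sixPhiTerm, sixPhiCert, sixPhiCert, sixPhiCore_shift h0 h1 h2 h3,
    sixPhiCore_succ, sixPhiRatio]
  obtain ⟨X, hX⟩ : ∃ X, X = q ^ (m + 1) := ⟨_, rfl⟩
  rw [show q ^ (m + 1 + 1) = q * q ^ (m + 1) by ring, show q ^ (2 * (m + 1)) = (q ^ (m + 1)) ^ 2 by ring,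
    show d * a * q * q ^ m = d * a * q ^ (m + 1) by ring,
    show c * q * q ^ m = c * q ^ (m + 1) by ring]
  rw [← hX] at k1 k2 k3 hq1 ⊢
  obtain ⟨R, hR⟩ : ∃ R, R = sixPhiCore d e c q a m := ⟨_, rfl⟩
  rw [← hR]
  -- The inverse of c becomes an independent variable f, with cf = 1 as the only relation; it enters
  -- the final identity once, through (1 - cX)(aqf).
  obtain ⟨f, hf⟩ : ∃ f, f = c⁻¹ := ⟨_, rfl⟩
  have hcf : c * f = 1 := by rw [hf, mul_inv_cancel₀ hc]
  simp only [div_eq_mul_inv _ c, ← hf] at h2 hd2 k2 ⊢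
  have hD : (1 - d * a * e * q * X) * (1 - d * a * f * q * X) * (1 - a * q * X) ≠ 0 :=
    mul_ne_zero (mul_ne_zero k1 k2) k3
  have ea : ∀ n0 n1 n2 n3 m1 m2 m3 t k1 k2 k3 g R X : ℂ, n0 ≠ 0 → m1 ≠ 0 → m2 ≠ 0 → m3 ≠ 0 →
      n0 * n1 * n2 * n3 / (m1 * m2 * m3) * (t * (R * (X * g * m1 * m2 * m3 / (n0 * k1 * k2 * k3)))) =
        R * (n1 * n2 * n3 * t * X * g) / (k1 * k2 * k3) := by
    intro n0 n1 n2 n3 m1 m2 m3 t k1 k2 k3 g R X h0 h1 h2 h3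
    field_simp
  have eb : ∀ u p R N k1 k2 k3 : ℂ, u ≠ 0 →
      u * p * (R * (N / (u * k1 * k2 * k3))) = R * (p * N) / (k1 * k2 * k3) := by
    intro u p R N k1 k2 k3 hu
    field_simp
  have key : ∀ x y u v D R : ℂ, D ≠ 0 → x * D - v = u * D - y →
      x * R - R * v / D = u * R - R * y / D := by
    intro x y u v D R hD h
    field_simp
    linear_combination R * h
  rw [ea _ _ _ _ _ _ _ _ _ _ _ _ _ _ hd0 hd1 hd2 hd3, eb _ _ _ _ _ _ _ hq1, ← mul_assoc (1 - a * q * e * f)]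
  refine key _ _ _ _ _ _ hD ?_
  linear_combination (-(a * q * X * (1 - d * a * (a * q * e * f) * (q * X)) *
    (1 - d * a * X) * (e - X) * (1 - d * X))) * hcf

/-! ### Majorants and limits of the series under a ↦ a q^n -/

theorem exists_norm_sixPhiCore_le {d e c q a : ℂ} (hq : ‖q‖ < 1)
    (h1 : ∀ i : ℕ, 1 - d * a * e * q * q ^ i ≠ 0) (h2 : ∀ i : ℕ, 1 - d * a / c * q * q ^ i ≠ 0)
    (h3 : ∀ i : ℕ, 1 - a * q * q ^ i ≠ 0) :
    ∃ C > 0, ∀ n m : ℕ, ‖sixPhiCore d e c q (a * q ^ n) m‖ ≤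
      C * ‖q‖ ^ n * ‖revPoch e q (m + 1) * (a * q / c) ^ (m + 1)‖ := by
  obtain ⟨C0, hC0, b0⟩ := exists_norm_qPoch_le hq ‖d * a * q‖
  obtain ⟨C1, hC1, b1⟩ := exists_norm_qPoch_le hq ‖c * q‖
  obtain ⟨C2, hC2, b2⟩ := exists_norm_qPoch_le hq ‖d‖
  obtain ⟨C3, hC3, b3⟩ := exists_norm_inv_qPoch_le hq (one_sub_pow_ne_zero hq)
  obtain ⟨C4, hC4, b4⟩ := exists_norm_inv_qPoch_le hq h1
  obtain ⟨C5, hC5, b5⟩ := exists_norm_inv_qPoch_le hq h2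
  obtain ⟨C6, hC6, b6⟩ := exists_norm_inv_qPoch_le hq h3
  refine ⟨C0 * C1 * C2 * C3 * C4 * C5 * C6, by positivity, fun n m => ?_⟩
  have e0 : d * (a * q ^ n) * q = d * a * q * q ^ n := by ring
  have e4 : d * (a * q ^ n) * e * q = d * a * e * q * q ^ n := by ring
  have e5 : d * (a * q ^ n) / c * q = d * a / c * q * q ^ n := by ring
  have e6 : a * q ^ n * q = a * q * q ^ n := by ring
  have e7 : a * q * q ^ n / c = q ^ n * (a * q / c) := by ring
  have b3' := b3 0 (m + 1)
  rw [pow_zero, mul_one] at b3'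
  -- The exponent is at least 1 because the constant term is left out; this gives the decay in n,
  -- uniformly in m.
  have b7 : ‖(q ^ n) ^ (m + 1)‖ ≤ ‖q‖ ^ n := by
    rw [norm_pow, norm_pow]
    exact pow_le_of_le_one (by positivity) (pow_le_one₀ (norm_nonneg q) hq.le) (Nat.succ_ne_zero m)
  rw [sixPhiCore, e0, e4, e5, e6, e7, mul_pow (q ^ n)]
  calc _ = ‖qPoch (d * a * q * q ^ n) q m‖ * ‖qPoch (c * q) q m‖ * ‖qPoch d q (m + 1)‖ *
        ‖(qPoch q q (m + 1))⁻¹‖ * ‖(qPoch (d * a * e * q * q ^ n) q (m + 1))⁻¹‖ *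
        ‖(qPoch (d * a / c * q * q ^ n) q (m + 1))⁻¹‖ * ‖(qPoch (a * q * q ^ n) q (m + 1))⁻¹‖ *
        ‖(q ^ n) ^ (m + 1)‖ * ‖revPoch e q (m + 1) * (a * q / c) ^ (m + 1)‖ := by
        simp only [norm_mul]; ring
    _ ≤ _ := by
        gcongr
        · exact b0 _ (norm_mul_pow_le hq _ n) m
        · exact b1 _ le_rfl m
        · exact b2 _ le_rfl _
        · exact b4 n _
        · exact b5 n _
        · exact b6 n _

theorem norm_one_sub_mul_pow_le {q : ℂ} (hq : ‖q‖ < 1) (x : ℂ) (n : ℕ) :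
    ‖1 - x * q ^ n‖ ≤ 1 + ‖x‖ :=
  (norm_sub_le _ _).trans (by rw [norm_one]; gcongr; exact norm_mul_pow_le hq x n)

theorem exists_norm_sixPhiTerm_le {d e c q a : ℂ} (hq : ‖q‖ < 1)
    (h1 : ∀ i : ℕ, 1 - d * a * e * q * q ^ i ≠ 0) (h2 : ∀ i : ℕ, 1 - d * a / c * q * q ^ i ≠ 0)
    (h3 : ∀ i : ℕ, 1 - a * q * q ^ i ≠ 0) :
    ∃ C > 0, ∀ n m : ℕ, ‖sixPhiTerm d e c q (a * q ^ n) m‖ ≤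
      C * ‖q‖ ^ n * ‖revPoch e q (m + 1) * (a * q / c) ^ (m + 1)‖ := by
  obtain ⟨C, hC, b⟩ := exists_norm_sixPhiCore_le hq h1 h2 h3
  refine ⟨(1 + ‖d * a‖) * C, by positivity, fun n m => ?_⟩
  rw [sixPhiTerm, norm_mul, mul_assoc (1 + ‖d * a‖), mul_assoc (1 + ‖d * a‖),
    show d * (a * q ^ n) * q ^ (2 * (m + 1)) = d * a * q ^ (n + 2 * (m + 1)) by ring]
  gcongr
  · exact norm_one_sub_mul_pow_le hq _ _
  · exact b n m

theorem tendsto_sixPhiCert {d e c q a : ℂ} (hq : ‖q‖ < 1)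
    (h1 : ∀ i : ℕ, 1 - d * a * e * q * q ^ i ≠ 0) (h2 : ∀ i : ℕ, 1 - d * a / c * q * q ^ i ≠ 0)
    (h3 : ∀ i : ℕ, 1 - a * q * q ^ i ≠ 0)
    (hT : Summable fun m : ℕ => ‖revPoch e q (m + 1) * (a * q / c) ^ (m + 1)‖) :
    Tendsto (sixPhiCert d e c q a) atTop (𝓝 0) := by
  obtain ⟨C, hC, b⟩ := exists_norm_sixPhiCore_le hq h1 h2 h3
  have hT' := hT.tendsto_atTop_zero.const_mul
    ((1 + ‖(1 : ℂ)‖) * (1 + ‖d * a * (a * q * e / c)‖) * C)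
  rw [mul_zero] at hT'
  refine squeeze_zero_norm (fun m => ?_) hT'
  have b' := b 0 m
  rw [pow_zero, pow_zero, mul_one, mul_one] at b'
  rw [sixPhiCert, norm_mul, norm_mul, mul_assoc _ C]
  gcongr
  · simpa only [one_mul] using norm_one_sub_mul_pow_le hq 1 (m + 1)
  · exact norm_one_sub_mul_pow_le hq _ _

/-- The sum of the `₆φ₅` series, without the constant term and the factor `1 - c`. -/
noncomputable def sixPhiSum (d e c q a : ℂ) : ℂ := ∑' m : ℕ, sixPhiTerm d e c q a m

theorem summable_sixPhiTerm {d e c q a : ℂ} (hq : ‖q‖ < 1)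
    (h1 : ∀ i : ℕ, 1 - d * a * e * q * q ^ i ≠ 0) (h2 : ∀ i : ℕ, 1 - d * a / c * q * q ^ i ≠ 0)
    (h3 : ∀ i : ℕ, 1 - a * q * q ^ i ≠ 0)
    (hT : Summable fun m : ℕ => ‖revPoch e q (m + 1) * (a * q / c) ^ (m + 1)‖) (n : ℕ) :
    Summable (sixPhiTerm d e c q (a * q ^ n)) := by
  obtain ⟨C, hC, b⟩ := exists_norm_sixPhiTerm_le hq h1 h2 h3
  exact Summable.of_norm_bounded (hT.mul_left (C * ‖q‖ ^ n)) (b n)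

theorem tendsto_sixPhiSum {d e c q a : ℂ} (hq : ‖q‖ < 1)
    (h1 : ∀ i : ℕ, 1 - d * a * e * q * q ^ i ≠ 0) (h2 : ∀ i : ℕ, 1 - d * a / c * q * q ^ i ≠ 0)
    (h3 : ∀ i : ℕ, 1 - a * q * q ^ i ≠ 0)
    (hT : Summable fun m : ℕ => ‖revPoch e q (m + 1) * (a * q / c) ^ (m + 1)‖) :
    Tendsto (fun n : ℕ => sixPhiSum d e c q (a * q ^ n)) atTop (𝓝 0) := by
  obtain ⟨C, hC, b⟩ := exists_norm_sixPhiTerm_le hq h1 h2 h3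
  have hl : Tendsto (fun n : ℕ =>
      C * ‖q‖ ^ n * ∑' m : ℕ, ‖revPoch e q (m + 1) * (a * q / c) ^ (m + 1)‖) atTop (𝓝 0) := by
    simpa using ((tendsto_pow_atTop_nhds_zero_of_lt_one (norm_nonneg q) hq).const_mul C).mul_const
      (∑' m : ℕ, ‖revPoch e q (m + 1) * (a * q / c) ^ (m + 1)‖)
  refine squeeze_zero_norm (fun n => ?_) hl
  rw [← tsum_mul_left]
  exact tsum_of_norm_bounded (hT.mul_left (C * ‖q‖ ^ n)).hasSum (b n)

/-- The certificate tends to 0, so only its value at m = 0 survives the telescoping. -/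
theorem sixPhiSum_contiguous {d e c q a : ℂ} (hq : ‖q‖ < 1) (hc : c ≠ 0)
    (h0 : ∀ i : ℕ, 1 - d * a * q * q ^ i ≠ 0)
    (h1 : ∀ i : ℕ, 1 - d * a * e * q * q ^ i ≠ 0) (h2 : ∀ i : ℕ, 1 - d * a / c * q * q ^ i ≠ 0)
    (h3 : ∀ i : ℕ, 1 - a * q * q ^ i ≠ 0)
    (hT : Summable fun m : ℕ => ‖revPoch e q (m + 1) * (a * q / c) ^ (m + 1)‖) :
    (1 - a * q * e / c) * sixPhiSum d e c q a -
      sixPhiRatio d e c q a * sixPhiSum d e c q (a * q) =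
      (1 - d * a * (a * q * e / c) * q) * (e - 1) * (1 - d) * (a * q / c) /
        ((1 - d * a * e * q) * (1 - d * a / c * q) * (1 - a * q)) := by
  have s0 := summable_sixPhiTerm hq h1 h2 h3 hT 0
  have s1 := summable_sixPhiTerm hq h1 h2 h3 hT 1
  rw [pow_zero, mul_one] at s0
  rw [pow_one] at s1
  have hs := ((s0.hasSum.mul_left (1 - a * q * e / c)).sub
    (s1.hasSum.mul_left (sixPhiRatio d e c q a))).tendsto_sum_nat
  have ht : Tendsto (fun n => sixPhiCert d e c q a 0 - sixPhiCert d e c q a n) atTop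
      (𝓝 (sixPhiCert d e c q a 0)) := by
    simpa using (tendsto_sixPhiCert hq h1 h2 h3 hT).const_sub (sixPhiCert d e c q a 0)
  have hu := tendsto_nhds_unique hs (ht.congr fun n => by
    rw [← Finset.sum_range_sub' (sixPhiCert d e c q a)]
    exact Finset.sum_congr rfl fun m _ => (sixPhi_contiguous hq hc h0 h1 h2 h3 m).symm)
  rw [sixPhiSum, sixPhiSum, hu, sixPhiCert, sixPhiCore]
  have hq1 : 1 - q ≠ 0 := by simpa using one_sub_pow_ne_zero hq 0
  simp only [qPoch, revPoch, zero_add, Finset.prod_range_one, Finset.prod_range_zero, pow_zero,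
    mul_one, one_mul, pow_one, div_eq_mul_inv, mul_inv]
  linear_combination ((1 - d * a * (a * q * e * c⁻¹) * q) * (e - 1) * (1 - d) * (a * q * c⁻¹) *
        ((1 - d * a * e * q)⁻¹ * (1 - d * a * c⁻¹ * q)⁻¹ * (1 - a * q)⁻¹)) *
        (mul_inv_cancel₀ hq1)

/-! ### Evaluation of the series for c = 1 and c = q^j -/

theorem eq_of_forall_eq_succ_of_tendsto {u : ℕ → ℂ} {l : ℂ} (h : ∀ n, u n = u (n + 1))
    (hu : Tendsto u atTop (𝓝 l)) : u 0 = l := by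
  have : ∀ n, u 0 = u n := fun n => by
    induction n with
    | zero => rfl
    | succ n ih => rw [ih, h n]
  exact tendsto_nhds_unique (tendsto_const_nhds.congr this) hu

theorem one_sub_shift_ne_zero {x q : ℂ} (h : ∀ i : ℕ, 1 - x * q ^ i ≠ 0) (n i : ℕ) :
    1 - x * q ^ n * q ^ i ≠ 0 := by
  simpa only [mul_assoc, ← pow_add] using h (n + i)

/-- The logarithmic derivative which compares the two sides of the limiting `WP`-Bailey
transformation. -/
noncomputable def lambertDefect (a k w q : ℂ) : ℂ :=
  lambert (k * w * q) q + lambert (a * q) q - lambert (k * q) q - lambert (a * w * q) q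

theorem summable_revPoch_mul_pow_shift {e a q : ℂ}
    (hT : Summable fun m : ℕ => ‖revPoch e q (m + 1) * (a * q) ^ (m + 1)‖) (hq : ‖q‖ < 1) (n : ℕ) :
    Summable fun m : ℕ => ‖revPoch e q (m + 1) * (a * q ^ n * q) ^ (m + 1)‖ := by
  refine Summable.of_nonneg_of_le (fun _ => norm_nonneg _) (fun m => ?_) hT
  rw [norm_mul, norm_mul]
  gcongr ?_ * ?_
  rw [norm_pow, norm_pow, show a * q ^ n * q = a * q * q ^ n by ring]
  gcongr
  exact norm_mul_pow_le hq _ n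

/-- For c = 1 both multipliers in the contiguous relation equal 1 - aeq. Hence S(a) - S(aq) is an
elementary fraction, and it cancels the first terms of the four Lambert series: the sum plus the
defect is invariant under a ↦ a q and tends to 0. -/
theorem sixPhiSum_one {d e q a : ℂ} (hq : ‖q‖ < 1)
    (h0 : ∀ i : ℕ, 1 - d * a * q * q ^ i ≠ 0) (h1 : ∀ i : ℕ, 1 - d * a * e * q * q ^ i ≠ 0)
    (h3 : ∀ i : ℕ, 1 - a * q * q ^ i ≠ 0) (h4 : ∀ i : ℕ, 1 - a * e * q * q ^ i ≠ 0)
    (hT : Summable fun m : ℕ => ‖revPoch e q (m + 1) * (a * q) ^ (m + 1)‖) :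
    sixPhiSum d e 1 q a = -lambertDefect a (d * a) e q := by
  have hT1 : Summable fun m : ℕ => ‖revPoch e q (m + 1) * (a * q / 1) ^ (m + 1)‖ := by
    simpa using hT
  have h2 : ∀ i : ℕ, 1 - d * a / 1 * q * q ^ i ≠ 0 := by simpa using h0
  have ht := (tendsto_sixPhiSum hq h1 h2 h3 hT1).add
    ((((tendsto_lambert hq h1).add (tendsto_lambert hq h3)).sub (tendsto_lambert hq h0)).sub
      (tendsto_lambert hq h4))
  have := eq_of_forall_eq_succ_of_tendsto (fun n => ?_) ht
  · simp only [pow_zero, mul_one, add_zero, sub_zero] at this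
    rw [lambertDefect, eq_neg_iff_add_eq_zero]
    exact this
  · have g0 := one_sub_shift_ne_zero h0 n
    have g1 := one_sub_shift_ne_zero h1 n
    have g3 := one_sub_shift_ne_zero h3 n
    have g4 := one_sub_shift_ne_zero h4 n
    rw [lambert_eq_add hq g0, lambert_eq_add hq g1, lambert_eq_add hq g3, lambert_eq_add hq g4]
    simp only [pow_succ, ← mul_assoc]
    have r0 : d * a * q * q ^ n = d * (a * q ^ n) * q := by ring
    have r1 : d * a * e * q * q ^ n = d * (a * q ^ n) * e * q := by ring
    have r3 : a * q * q ^ n = a * q ^ n * q := by ring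
    have r4 : a * e * q * q ^ n = a * q ^ n * e * q := by ring
    rw [r0] at g0 ⊢
    rw [r1] at g1 ⊢
    rw [r3] at g3 ⊢
    rw [r4] at g4 ⊢
    have hTn := summable_revPoch_mul_pow_shift hT hq n
    -- The step from n to n + 1 is the step b ↦ b q at a general parameter b.
    generalize a * q ^ n = b at *
    have key := sixPhiSum_contiguous (c := 1) hq one_ne_zero g0 g1 (by simpa using g0) g3
      (by simpa using hTn)
    have k0 : 1 - d * b * q ≠ 0 := by simpa using g0 0
    have k1 : 1 - d * b * e * q ≠ 0 := by simpa using g1 0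
    have k3 : 1 - b * q ≠ 0 := by simpa using g3 0
    have k4 : 1 - b * e * q ≠ 0 := by simpa using g4 0
    have hr : sixPhiRatio d e 1 q b = 1 - b * e * q := by
      rw [sixPhiRatio, div_eq_iff (by simpa using ⟨⟨k1, k0⟩, k3⟩)]
      ring
    rw [hr, div_one, div_one, show b * q * e = b * e * q by ring, ← mul_sub,
      mul_comm (1 - b * e * q), ← eq_div_iff k4, sub_eq_iff_eq_add] at key
    rw [key, div_one]
    generalize sixPhiSum d e 1 q (b * q) = S
    generalize lambert _ _ = L1
    generalize lambert _ _ = L2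
    generalize lambert _ _ = L3
    generalize lambert _ _ = L4
    field_simp
    ring

/-- The closed form of the `₆φ₅` series with `c = q ^ j` and `a = b q ^ j`. -/
noncomputable def sixPhiValue (d e q b : ℂ) (j : ℕ) : ℂ :=
  qPoch (d * b * e * q) q j * qPoch (b * q) q j / (qPoch (d * b * q) q j * qPoch (b * e * q) q j)

theorem continuous_qPoch (q : ℂ) (n : ℕ) : Continuous fun x => qPoch x q n := by
  unfold qPoch
  fun_prop

theorem tendsto_qPoch_mul_pow {q : ℂ} (hq : ‖q‖ < 1) (x : ℂ) (j : ℕ) :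
    Tendsto (fun n : ℕ => qPoch (x * q ^ n) q j) atTop (𝓝 1) := by
  have h : Tendsto (fun n : ℕ => x * q ^ n) atTop (𝓝 0) := by
    simpa using (tendsto_pow_atTop_nhds_zero_of_norm_lt_one hq).const_mul x
  simpa [qPoch, Function.comp_def] using ((continuous_qPoch q j).tendsto 0).comp h

theorem tendsto_sixPhiValue {q : ℂ} (hq : ‖q‖ < 1) (d e b : ℂ) (j : ℕ) :
    Tendsto (fun n : ℕ => sixPhiValue d e q (b * q ^ n) j) atTop (𝓝 1) := by
  have h := ((tendsto_qPoch_mul_pow hq (d * b * e * q) j).mul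
    (tendsto_qPoch_mul_pow hq (b * q) j)).div
    ((tendsto_qPoch_mul_pow hq (d * b * q) j).mul (tendsto_qPoch_mul_pow hq (b * e * q) j))
    (by norm_num)
  rw [mul_one, div_one] at h
  refine h.congr fun n => ?_
  rw [sixPhiValue, show d * (b * q ^ n) * e * q = d * b * e * q * q ^ n by ring,
    show b * q ^ n * q = b * q * q ^ n by ring,
    show d * (b * q ^ n) * q = d * b * q * q ^ n by ring,
    show b * q ^ n * e * q = b * e * q * q ^ n by ring]
  rfl

theorem sixPhiValue_ne_zero {d e q b : ℂ}
    (h1 : ∀ i : ℕ, 1 - d * b * e * q * q ^ i ≠ 0) (h2 : ∀ i : ℕ, 1 - d * b * q * q ^ i ≠ 0)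
    (h3 : ∀ i : ℕ, 1 - b * q * q ^ i ≠ 0) (h4 : ∀ i : ℕ, 1 - b * e * q * q ^ i ≠ 0) (j : ℕ) :
    sixPhiValue d e q b j ≠ 0 :=
  div_ne_zero (mul_ne_zero (qPoch_ne_zero h1 j) (qPoch_ne_zero h3 j))
    (mul_ne_zero (qPoch_ne_zero h2 j) (qPoch_ne_zero h4 j))

theorem sixPhiRatio_eq {d e q b : ℂ} (hq : q ≠ 0) (j : ℕ) :
    sixPhiRatio d e (q ^ j) q (b * q ^ j) =
      (1 - d * b * q * q ^ j) * (1 - d * b * e * q) * (1 - b * e * q * q ^ j) * (1 - b * q) /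
        ((1 - d * b * e * q * q ^ j) * (1 - d * b * q) * (1 - b * q * q ^ j)) := by
  have hc : q ^ j ≠ 0 := pow_ne_zero _ hq
  rw [sixPhiRatio, show d * (b * q ^ j) * q = d * b * q * q ^ j by ring,
    show d * b * q * q ^ j * e / q ^ j = d * b * e * q by field_simp,
    show b * q ^ j * q * e = b * e * q * q ^ j by ring,
    show b * q ^ j * q / q ^ j = b * q by field_simp,
    show d * (b * q ^ j) * e * q = d * b * e * q * q ^ j by ring,
    show d * (b * q ^ j) / q ^ j * q = d * b * q by field_simp,
    show b * q ^ j * q = b * q * q ^ j by ring]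

theorem sixPhiValue_shift {d e q b : ℂ} (hq : q ≠ 0)
    (h1 : ∀ i : ℕ, 1 - d * b * e * q * q ^ i ≠ 0) (h2 : ∀ i : ℕ, 1 - d * b * q * q ^ i ≠ 0)
    (h3 : ∀ i : ℕ, 1 - b * q * q ^ i ≠ 0) (h4 : ∀ i : ℕ, 1 - b * e * q * q ^ i ≠ 0) (j : ℕ) :
    (1 - b * e * q) * sixPhiValue d e q b j =
      sixPhiRatio d e (q ^ j) q (b * q ^ j) * sixPhiValue d e q (b * q) j := by
  have k1 : 1 - d * b * e * q ≠ 0 := by simpa using h1 0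
  have k2 : 1 - d * b * q ≠ 0 := by simpa using h2 0
  have k3 : 1 - b * q ≠ 0 := by simpa using h3 0
  have key : ∀ x : ℂ, 1 - x * q ≠ 0 →
      qPoch (x * q * q) q j = qPoch (x * q) q j * (1 - x * q * q ^ j) / (1 - x * q) :=
    fun x hx => by rw [eq_div_iff hx, qPoch_mul_shift]
  have k4 : 1 - b * e * q ≠ 0 := by simpa using h4 0
  rw [sixPhiRatio_eq hq, sixPhiValue, sixPhiValue,
    show d * (b * q) * e * q = d * b * e * q * q by ring,
    show d * (b * q) * q = d * b * q * q by ring,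
    show b * q * e * q = b * e * q * q by ring, key _ k1, key _ k2, key _ k3, key _ k4]
  have g1 := h1 j
  have g2 := h2 j
  have g3 := h3 j
  have g4 := h4 j
  have p1 := qPoch_ne_zero h1 j
  have p2 := qPoch_ne_zero h2 j
  have p3 := qPoch_ne_zero h3 j
  have p4 := qPoch_ne_zero h4 j
  generalize qPoch _ q j = P1 at *
  generalize qPoch _ q j = P2 at *
  generalize qPoch _ q j = P3 at *
  generalize qPoch _ q j = P4 at *
  generalize 1 - d * b * e * q * q ^ j = x1 at *
  generalize 1 - d * b * q * q ^ j = x2 at *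
  generalize 1 - b * q * q ^ j = x3 at *
  generalize 1 - b * e * q * q ^ j = x4 at *
  generalize 1 - d * b * e * q = x5 at *
  generalize 1 - d * b * q = x6 at *
  generalize 1 - b * q = x7 at *
  generalize 1 - b * e * q = x8 at *
  field_simp

/-- Restoring the constant term and the factor 1 - c absorbs the boundary term and makes the
relation homogeneous; `sixPhiValue_shift` is the same recurrence for the closed form. -/
theorem one_add_sixPhiSum_shift {d e q b : ℂ} (hq1 : ‖q‖ < 1) (hq : q ≠ 0) (j : ℕ)
    (h1 : ∀ i : ℕ, 1 - d * b * e * q * q ^ i ≠ 0) (h2 : ∀ i : ℕ, 1 - d * b * q * q ^ i ≠ 0)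
    (h3 : ∀ i : ℕ, 1 - b * q * q ^ i ≠ 0)
    (hT : Summable fun m : ℕ => ‖revPoch e q (m + 1) * (b * q) ^ (m + 1)‖) :
    (1 - b * e * q) * (1 + (1 - q ^ j) * sixPhiSum d e (q ^ j) q (b * q ^ j)) =
      sixPhiRatio d e (q ^ j) q (b * q ^ j) *
        (1 + (1 - q ^ j) * sixPhiSum d e (q ^ j) q (b * q ^ j * q)) := by
  have hc : q ^ j ≠ 0 := pow_ne_zero _ hq
  have e0 : d * (b * q ^ j) * q = d * b * q * q ^ j := by ring
  have e1 : d * (b * q ^ j) * e * q = d * b * e * q * q ^ j := by ring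
  have e2 : d * (b * q ^ j) / q ^ j * q = d * b * q := by field_simp
  have e3 : b * q ^ j * q = b * q * q ^ j := by ring
  have e4 : b * q * q ^ j / q ^ j = b * q := by field_simp
  have key := sixPhiSum_contiguous (d := d) (e := e) (c := q ^ j) (a := b * q ^ j) hq1 hc
    (by rw [e0]; exact one_sub_shift_ne_zero h2 j) (by rw [e1]; exact one_sub_shift_ne_zero h1 j)
    (by rw [e2]; exact h2) (by rw [e3]; exact one_sub_shift_ne_zero h3 j)
    (by rw [e3, e4]; exact hT)
  rw [sixPhiRatio_eq hq] at key ⊢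
  have e5 : b * q ^ j * q * e / q ^ j = b * e * q := by field_simp
  rw [e5, e1, e2, e3, e4] at key
  rw [e3]
  have k1 : 1 - d * b * q ≠ 0 := by simpa using h2 0
  have g1 := h1 j
  have g3 := h3 j
  generalize sixPhiSum d e (q ^ j) q (b * q ^ j) = S at *
  generalize sixPhiSum d e (q ^ j) q (b * q * q ^ j) = S' at *
  obtain ⟨X, hX⟩ : ∃ X, X = q ^ j := ⟨_, rfl⟩
  rw [← hX] at key g1 g3 ⊢
  have hpoly : (1 - b * e * q) - (1 - d * b * q * X) * (1 - d * b * e * q) * (1 - b * e * q * X) *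
      (1 - b * q) / ((1 - d * b * e * q * X) * (1 - d * b * q) * (1 - b * q * X)) +
      (1 - X) * ((1 - d * (b * X) * (b * e * q) * q) * (e - 1) * (1 - d) * (b * q) /
        ((1 - d * b * e * q * X) * (1 - d * b * q) * (1 - b * q * X))) = 0 := by
    have hD : (1 - d * b * e * q * X) * (1 - d * b * q) * (1 - b * q * X) ≠ 0 :=
      mul_ne_zero (mul_ne_zero g1 k1) g3
    have aux : ∀ x y z D : ℂ, D ≠ 0 → x * D - y + z = 0 → x - y / D + z / D = 0 := by
      intro x y z D hD h
      field_simp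
      linear_combination h
    rw [← mul_div_assoc]
    refine aux _ _ _ _ hD ?_
    ring
  linear_combination (1 - X) * key + hpoly

/-- The `₆φ₅` summation with one parameter equal to `q ^ j`. -/
theorem one_add_sixPhiSum_pow {d e q b : ℂ} (hq1 : ‖q‖ < 1) (hq : q ≠ 0) (j : ℕ)
    (h1 : ∀ i : ℕ, 1 - d * b * e * q * q ^ i ≠ 0) (h2 : ∀ i : ℕ, 1 - d * b * q * q ^ i ≠ 0)
    (h3 : ∀ i : ℕ, 1 - b * q * q ^ i ≠ 0) (h4 : ∀ i : ℕ, 1 - b * e * q * q ^ i ≠ 0)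
    (hT : Summable fun m : ℕ => ‖revPoch e q (m + 1) * (b * q) ^ (m + 1)‖) :
    1 + (1 - q ^ j) * sixPhiSum d e (q ^ j) q (b * q ^ j) = sixPhiValue d e q b j := by
  have hc : q ^ j ≠ 0 := pow_ne_zero _ hq
  have e0 : d * (b * q ^ j) * q = d * b * q * q ^ j := by ring
  have e1 : d * (b * q ^ j) * e * q = d * b * e * q * q ^ j := by ring
  have e2 : d * (b * q ^ j) / q ^ j * q = d * b * q := by field_simp
  have e3 : b * q ^ j * q = b * q * q ^ j := by ring
  have e4 : b * q * q ^ j / q ^ j = b * q := by field_simp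
  -- The quotient of series and closed form is unchanged by b ↦ b q and tends to 1.
  have ht := (((tendsto_sixPhiSum (d := d) (e := e) (c := q ^ j) (a := b * q ^ j) hq1
    (by rw [e1]; exact one_sub_shift_ne_zero h1 j) (by rw [e2]; exact h2)
    (by rw [e3]; exact one_sub_shift_ne_zero h3 j) (by rw [e3, e4]; exact hT)).const_mul
      (1 - q ^ j)).const_add 1).div (tendsto_sixPhiValue hq1 d e b j) one_ne_zero
  have := eq_of_forall_eq_succ_of_tendsto (fun n => ?_) ht
  · simp only [Pi.div_apply, pow_zero, mul_one, mul_zero, add_zero, div_one] at this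
    rwa [div_eq_one_iff_eq (sixPhiValue_ne_zero h1 h2 h3 h4 j)] at this
  · simp only [Pi.div_apply]
    have r1 : d * b * e * q * q ^ n = d * (b * q ^ n) * e * q := by ring
    have r2 : d * b * q * q ^ n = d * (b * q ^ n) * q := by ring
    have r3 : b * q * q ^ n = b * q ^ n * q := by ring
    have r4 : b * e * q * q ^ n = b * q ^ n * e * q := by ring
    have g1 := one_sub_shift_ne_zero h1 n
    have g2 := one_sub_shift_ne_zero h2 n
    have g3 := one_sub_shift_ne_zero h3 n
    have g4 := one_sub_shift_ne_zero h4 n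
    rw [r1] at g1
    rw [r2] at g2
    rw [r3] at g3
    rw [r4] at g4
    have hTn := summable_revPoch_mul_pow_shift hT hq1 n
    rw [show b * q ^ j * q ^ n = b * q ^ n * q ^ j by ring,
      show b * q ^ j * q ^ (n + 1) = b * q ^ n * q ^ j * q by ring,
      show b * q ^ (n + 1) = b * q ^ n * q by ring]
    generalize b * q ^ n = B at *
    have hn := sixPhiValue_ne_zero g1 g2 g3 g4 j
    have k4 : 1 - B * e * q ≠ 0 := by simpa using g4 0
    have s1 := one_add_sixPhiSum_shift hq1 hq j g1 g2 g3 hTn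
    have s2 := sixPhiValue_shift hq g1 g2 g3 g4 j
    have hn' : sixPhiRatio d e (q ^ j) q (B * q ^ j) * sixPhiValue d e q (B * q) j ≠ 0 := by
      rw [← s2]; exact mul_ne_zero k4 hn
    rw [div_eq_div_iff hn (right_ne_zero_of_mul hn')]
    apply mul_left_cancel₀ (mul_ne_zero k4 (left_ne_zero_of_mul hn'))
    linear_combination sixPhiRatio d e (q ^ j) q (B * q ^ j) * sixPhiValue d e q (B * q) j * s1 -
      sixPhiRatio d e (q ^ j) q (B * q ^ j) *
        (1 + (1 - q ^ j) * sixPhiSum d e (q ^ j) q (B * q ^ j * q)) * s2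

/-! ### Interchange of summation -/

/-- The coefficient of `β n` in the `β`-weighted series, as a function of `w = 1 / z`. -/
noncomputable def betaWeight (a k w q : ℂ) : ℕ → ℂ
  | 0 => 0
  | n + 1 => (1 - k * q ^ (2 * (n + 1))) * revPoch w q (n + 1) * qPoch q q n * (1 - k)⁻¹ *
      (qPoch (k * q) q (n + 1))⁻¹ * (qPoch (k * w * q) q (n + 1))⁻¹ * (a * q) ^ (n + 1)

/-- The coefficient of `α (n + 1)` in the `α`-weighted series, as a function of `w = 1 / z`. -/
noncomputable def alphaWeight (a w q : ℂ) (n : ℕ) : ℂ :=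
  revPoch w q (n + 1) * qPoch q q n * (qPoch (a * q) q (n + 1))⁻¹ *
    (qPoch (a * w * q) q (n + 1))⁻¹ * (a * q) ^ (n + 1)

/-- The coefficient of `α j` in `β (j + m)` for a `WP`-Bailey pair. -/
noncomputable def baileyKernel (a k q : ℂ) (j m : ℕ) : ℂ :=
  qPoch (k / a) q m * qPoch k q (2 * j + m) * (qPoch q q m)⁻¹ * (qPoch (a * q) q (2 * j + m))⁻¹

theorem revPoch_add (w q : ℂ) (j m : ℕ) (hq : q ≠ 0) :
    revPoch w q (j + m) = revPoch w q j * ((q ^ j) ^ m * revPoch (w / q ^ j) q m) := by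
  rw [revPoch, Finset.prod_range_add, revPoch, revPoch]
  congr 1
  rw [← Finset.card_range m, ← Finset.prod_const, Finset.card_range, ← Finset.prod_mul_distrib]
  refine Finset.prod_congr rfl fun i _ => ?_
  have : q ^ j ≠ 0 := pow_ne_zero _ hq
  field_simp
  ring

/-- The factor (q; q)_{n-1} of the weight is (cq; q)_{n-1} at c = 1, so row 0 is the series with 1 -
c removed. -/
theorem betaWeight_mul_baileyKernel_zero {a k w q : ℂ} (ha : a ≠ 0) (hk : 1 - k ≠ 0) (m : ℕ) :
    betaWeight a k w q (m + 1) * baileyKernel a k q 0 (m + 1) = sixPhiTerm (k / a) w 1 q a m := by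
  rw [betaWeight, baileyKernel, sixPhiTerm, sixPhiCore, div_mul_cancel₀ _ ha, div_one, div_one,
    one_mul, mul_zero, zero_add, qPoch_succ' k]
  linear_combination ((1 - k * q ^ (2 * (m + 1))) * revPoch w q (m + 1) * qPoch q q m *
    (qPoch (k * q) q (m + 1))⁻¹ * (qPoch (k * w * q) q (m + 1))⁻¹ * (a * q) ^ (m + 1) *
    qPoch (k / a) q (m + 1) * qPoch (k * q) q m * (qPoch q q (m + 1))⁻¹ *
    (qPoch (a * q) q (m + 1))⁻¹) * mul_inv_cancel₀ hk

theorem betaWeight_mul_baileyKernel_succ {a k w q : ℂ} (hq : q ≠ 0) (ha : a ≠ 0) (j m : ℕ) :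
    betaWeight a k w q (j + 1 + (m + 1)) * baileyKernel a k q (j + 1) (m + 1) =
      betaWeight a k w q (j + 1) * baileyKernel a k q (j + 1) 0 * ((1 - q ^ (j + 1)) *
        sixPhiTerm (k / a) (w / q ^ (j + 1)) (q ^ (j + 1)) q (a * q ^ (j + 1) * q ^ (j + 1)) m) := by
  have hc : q ^ (j + 1) ≠ 0 := pow_ne_zero _ hq
  have e0 : k / a * (a * q ^ (j + 1) * q ^ (j + 1)) = k * q ^ (2 * (j + 1)) := by
    rw [show q ^ (2 * (j + 1)) = q ^ (j + 1) * q ^ (j + 1) by ring]; field_simp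
  have e1 : k * q ^ (2 * (j + 1)) * (w / q ^ (j + 1)) = k * w * q ^ (j + 1) := by
    rw [two_mul, pow_add]; field_simp
  have e2 : k * q ^ (2 * (j + 1)) / q ^ (j + 1) = k * q ^ (j + 1) := by
    rw [two_mul, pow_add]; field_simp
  have e3 : a * q ^ (j + 1) * q ^ (j + 1) * q / q ^ (j + 1) = a * q * q ^ (j + 1) := by
    field_simp
  have e4 : a * q ^ (j + 1) * q ^ (j + 1) = a * q ^ (2 * (j + 1)) := by ring
  rw [show j + 1 + (m + 1) = (j + 1 + m) + 1 by ring, betaWeight,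
    show j + 1 + m + 1 = (j + 1) + (m + 1) by ring, betaWeight, baileyKernel, baileyKernel,
    sixPhiTerm, sixPhiCore, e0, e1, e2, e3, e4, revPoch_add _ _ _ _ hq, qPoch_add q q (j + 1) m,
    qPoch_succ q q j, qPoch_add (k * q), qPoch_add (k * w * q), qPoch_add (a * q),
    qPoch_add k q (2 * (j + 1)), qPoch_succ' (k * q ^ (2 * (j + 1))), qPoch_zero]
  simp only [mul_inv, add_zero, inv_one, qPoch_zero]
  rw [show k * q ^ (j + 1) * q = k * q * q ^ (j + 1) by ring,
    show k * w * q ^ (j + 1) * q = k * w * q * q ^ (j + 1) by ring,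
    show a * q ^ (2 * (j + 1)) * q = a * q * q ^ (2 * (j + 1)) by ring,
    show k * q ^ (2 * (j + 1)) * q ^ (2 * (m + 1)) = k * q ^ (2 * (j + 1 + (m + 1))) by ring,
    show q ^ (j + 1) * q = q * q ^ (j + 1) by ring, mul_pow (a * q) (q ^ (j + 1)),
    pow_add (a * q) (j + 1) (m + 1)]
  ring

/-- The k-dependence cancels through (1 - kq^(2n)) (k)_{2n} = (1 - k) (kq)_{2n} with n = j + 1. -/
theorem betaWeight_mul_sixPhiValue {a k w q : ℂ} (hq : q ≠ 0) (ha : a ≠ 0)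
    (hk : ∀ i : ℕ, 1 - k * q ^ i ≠ 0) (haq : ∀ i : ℕ, 1 - a * q * q ^ i ≠ 0)
    (hkw : ∀ i : ℕ, 1 - k * w * q * q ^ i ≠ 0) (j : ℕ) :
    betaWeight a k w q (j + 1) * baileyKernel a k q (j + 1) 0 *
      sixPhiValue (k / a) (w / q ^ (j + 1)) q (a * q ^ (j + 1)) (j + 1) = alphaWeight a w q j := by
  have hc : q ^ (j + 1) ≠ 0 := pow_ne_zero _ hq
  have e0 : k / a * (a * q ^ (j + 1)) = k * q ^ (j + 1) := by field_simp
  have e1 : k * q ^ (j + 1) * (w / q ^ (j + 1)) = k * w := by field_simp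
  have e2 : a * q ^ (j + 1) * (w / q ^ (j + 1)) = a * w := by field_simp
  have hkq : ∀ i : ℕ, 1 - k * q * q ^ i ≠ 0 := fun i => by
    simpa only [pow_one] using one_sub_shift_ne_zero hk 1 i
  have hk0 : 1 - k ≠ 0 := by simpa using hk 0
  have p1 := qPoch_ne_zero hkq (j + 1)
  have p2 := qPoch_ne_zero (one_sub_shift_ne_zero hkq (j + 1)) (j + 1)
  have p3 := qPoch_ne_zero hkw (j + 1)
  have p4 := qPoch_ne_zero (one_sub_shift_ne_zero haq (j + 1)) (j + 1)
  have p5 := qPoch_ne_zero haq (j + 1)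
  have s : (1 - k * q ^ (2 * (j + 1))) * qPoch k q (2 * (j + 1)) =
      (1 - k) * (qPoch (k * q) q (j + 1) * qPoch (k * q * q ^ (j + 1)) q (j + 1)) := by
    rw [mul_comm, ← qPoch_succ, qPoch_succ', two_mul, qPoch_add]
  rw [betaWeight, baileyKernel, sixPhiValue, alphaWeight, e0, e1, e2, add_zero,
    show k * q ^ (j + 1) * q = k * q * q ^ (j + 1) by ring,
    show a * q ^ (j + 1) * q = a * q * q ^ (j + 1) by ring, two_mul, qPoch_add (a * q),
    ← two_mul, qPoch_zero, qPoch_zero]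
  generalize qPoch (k * q) q (j + 1) = P1 at *
  generalize qPoch (k * q * q ^ (j + 1)) q (j + 1) = P2 at *
  generalize qPoch (k * w * q) q (j + 1) = P3 at *
  generalize qPoch (a * q * q ^ (j + 1)) q (j + 1) = P4 at *
  generalize qPoch (a * q) q (j + 1) = P5 at *
  generalize qPoch k q (2 * (j + 1)) = P6 at *
  generalize (qPoch (a * w * q) q (j + 1)) = P7
  generalize 1 - k * q ^ (2 * (j + 1)) = x at *
  generalize 1 - k = y at *
  calc _ = (x * P6) * (y⁻¹ * P1⁻¹ * P2⁻¹) * (P3⁻¹ * P3) * (P4⁻¹ * P4) * revPoch w q (j + 1) *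
        qPoch q q j * P5⁻¹ * P7⁻¹ * (a * q) ^ (j + 1) := by
        simp only [div_eq_mul_inv, mul_inv, inv_one]
        ring
    _ = _ := by
        rw [s, inv_mul_cancel₀ p3, inv_mul_cancel₀ p4]
        field_simp

theorem tsum_betaWeight_mul_baileyKernel_zero {a k w q : ℂ} (hq1 : ‖q‖ < 1) (ha : a ≠ 0)
    (hk : ∀ i : ℕ, 1 - k * q ^ i ≠ 0) (haq : ∀ i : ℕ, 1 - a * q * q ^ i ≠ 0)
    (hkw : ∀ i : ℕ, 1 - k * w * q * q ^ i ≠ 0) (haw : ∀ i : ℕ, 1 - a * w * q * q ^ i ≠ 0)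
    (hW : Summable fun m : ℕ => ‖revPoch w q m * (a * q) ^ m‖) :
    ∑' m, betaWeight a k w q m * baileyKernel a k q 0 m = -lambertDefect a k w q := by
  have e0 : k / a * a = k := div_mul_cancel₀ _ ha
  have hkq : ∀ i : ℕ, 1 - k * q * q ^ i ≠ 0 := fun i => by
    simpa only [pow_one] using one_sub_shift_ne_zero hk 1 i
  have hT := (summable_nat_add_iff 1).2 hW
  have h := sixPhiSum_one (d := k / a) (e := w) hq1 (by rwa [e0]) (by rwa [e0]) haq haw hT
  have hs := summable_sixPhiTerm (d := k / a) (e := w) (c := 1) hq1 (by rwa [e0])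
    (by rwa [e0, div_one]) haq (by simpa using hT) 0
  rw [pow_zero, mul_one] at hs
  rw [e0] at h
  replace hs : Summable fun m => betaWeight a k w q (m + 1) * baileyKernel a k q 0 (m + 1) :=
    hs.congr fun m => (betaWeight_mul_baileyKernel_zero ha (by simpa using hk 0 : 1 - k ≠ 0) m).symm
  rw [((summable_nat_add_iff (f := fun m => betaWeight a k w q m * baileyKernel a k q 0 m) 1).1
    hs).tsum_eq_zero_add, ← h, sixPhiSum]
  simp only [betaWeight_mul_baileyKernel_zero ha (by simpa using hk 0 : 1 - k ≠ 0)]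
  simp [betaWeight]

theorem tsum_betaWeight_mul_baileyKernel_succ {a k w q : ℂ} (hq1 : ‖q‖ < 1) (hq : q ≠ 0)
    (ha : a ≠ 0)
    (hk : ∀ i : ℕ, 1 - k * q ^ i ≠ 0) (haq : ∀ i : ℕ, 1 - a * q * q ^ i ≠ 0)
    (hkw : ∀ i : ℕ, 1 - k * w * q * q ^ i ≠ 0) (haw : ∀ i : ℕ, 1 - a * w * q * q ^ i ≠ 0)
    (hW : Summable fun m : ℕ => ‖revPoch w q m * (a * q) ^ m‖) (j : ℕ) :
    ∑' m, betaWeight a k w q (j + 1 + m) * baileyKernel a k q (j + 1) m = alphaWeight a w q j := by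
  -- If this factor vanishes, so does the whole row; otherwise it can be divided out of `hW` to get
  -- convergence of the shifted series.
  by_cases hw : revPoch w q (j + 1) = 0
  · have : ∀ m, betaWeight a k w q (j + 1 + m) = 0 := fun m => by
      rw [show j + 1 + m = (j + m) + 1 by ring, betaWeight, show j + m + 1 = j + 1 + m by ring,
        revPoch_add _ _ _ _ hq, hw]
      ring
    simp [this, alphaWeight, hw]
  have hc : q ^ (j + 1) ≠ 0 := pow_ne_zero _ hq
  have hkq : ∀ i : ℕ, 1 - k * q * q ^ i ≠ 0 := fun i => by
    simpa only [pow_one] using one_sub_shift_ne_zero hk 1 i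
  have e0 : k / a * (a * q ^ (j + 1)) = k * q ^ (j + 1) := by field_simp
  have e1 : k * q ^ (j + 1) * (w / q ^ (j + 1)) = k * w := by field_simp
  have e2 : a * q ^ (j + 1) * (w / q ^ (j + 1)) = a * w := by field_simp
  have e3 : k * q ^ (j + 1) * q = k * q * q ^ (j + 1) := by ring
  have e4 : a * q ^ (j + 1) * q = a * q * q ^ (j + 1) := by ring
  have hT : Summable fun m : ℕ =>
      ‖revPoch (w / q ^ (j + 1)) q (m + 1) * (a * q ^ (j + 1) * q) ^ (m + 1)‖ := by
    have h := ((summable_nat_add_iff (j + 1 + 1)).2 hW).mul_left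
      ‖(revPoch w q (j + 1) * (a * q) ^ (j + 1))⁻¹‖
    refine h.congr fun m => ?_
    rw [← norm_mul, show m + (j + 1 + 1) = (j + 1) + (m + 1) by ring, revPoch_add w q (j + 1) (m + 1) hq,
      pow_add (a * q) (j + 1) (m + 1), e4, mul_pow (a * q) (q ^ (j + 1))]
    congr 1
    have h1 : (a * q) ^ (j + 1) ≠ 0 := pow_ne_zero _ (mul_ne_zero ha hq)
    generalize (a * q) ^ (j + 1) = x at *
    generalize (a * q) ^ (m + 1) = y at *
    field_simp
  have h1 : ∀ i, 1 - k / a * (a * q ^ (j + 1)) * (w / q ^ (j + 1)) * q * q ^ i ≠ 0 := by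
    rwa [e0, e1]
  have h2 : ∀ i, 1 - k / a * (a * q ^ (j + 1)) * q * q ^ i ≠ 0 := by
    rw [e0, e3]; exact one_sub_shift_ne_zero hkq _
  have h3 : ∀ i, 1 - a * q ^ (j + 1) * q * q ^ i ≠ 0 := by
    rw [e4]; exact one_sub_shift_ne_zero haq _
  have h4 : ∀ i, 1 - a * q ^ (j + 1) * (w / q ^ (j + 1)) * q * q ^ i ≠ 0 := by rwa [e2]
  have key := one_add_sixPhiSum_pow hq1 hq (j + 1) h1 h2 h3 h4 hT
  have f1 : k / a * (a * q ^ (j + 1) * q ^ (j + 1)) * (w / q ^ (j + 1)) * q =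
      k / a * (a * q ^ (j + 1)) * (w / q ^ (j + 1)) * q * q ^ (j + 1) := by ring
  have f2 : k / a * (a * q ^ (j + 1) * q ^ (j + 1)) / q ^ (j + 1) * q =
      k / a * (a * q ^ (j + 1)) * q := by field_simp
  have f3 : a * q ^ (j + 1) * q ^ (j + 1) * q = a * q ^ (j + 1) * q * q ^ (j + 1) := by ring
  have f4 : a * q ^ (j + 1) * q * q ^ (j + 1) / q ^ (j + 1) = a * q ^ (j + 1) * q := by
    field_simp
  have hs := summable_sixPhiTerm (d := k / a) (e := w / q ^ (j + 1)) (c := q ^ (j + 1))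
    (a := a * q ^ (j + 1) * q ^ (j + 1)) hq1
    (by rw [f1]; exact one_sub_shift_ne_zero h1 _) (by rw [f2]; exact h2)
    (by rw [f3]; exact one_sub_shift_ne_zero h3 _) (by rw [f3, f4]; exact hT) 0
  rw [pow_zero, mul_one] at hs
  have hs' := (hs.mul_left (1 - q ^ (j + 1))).mul_left
    (betaWeight a k w q (j + 1) * baileyKernel a k q (j + 1) 0)
  simp only [← betaWeight_mul_baileyKernel_succ hq ha] at hs'
  rw [((summable_nat_add_iff (f := fun m => betaWeight a k w q (j + 1 + m) *
    baileyKernel a k q (j + 1) m) 1).1 hs').tsum_eq_zero_add]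
  simp only [betaWeight_mul_baileyKernel_succ hq ha]
  rw [tsum_mul_left, tsum_mul_left, ← sixPhiSum, add_zero, ← mul_one_add, key,
    betaWeight_mul_sixPhiValue hq ha hk haq hkw]

/-- With m = n - j one has n + j = 2j + m. The case n = 0 uses the normalisation α₀ = β₀ = 1. -/
theorem IsWPBaileyPair.eq_sum_antidiagonal {a k q : ℂ} {α β : ℕ → ℂ}
    (h : IsWPBaileyPair a k q α β) (n : ℕ) :
    β n = ∑ p ∈ Finset.HasAntidiagonal.antidiagonal n, baileyKernel a k q p.1 p.2 * α p.1 := by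
  rcases Nat.eq_zero_or_pos n with rfl | hn
  · simp [h.1, h.2.1, baileyKernel, qPoch]
  · rw [h.2.2 n hn, Finset.Nat.sum_antidiagonal_eq_sum_range_succ
      (fun j m => baileyKernel a k q j m * α j)]
    refine Finset.sum_congr rfl fun j hj => ?_
    have : n + j = 2 * j + (n - j) := by
      have := Finset.mem_range.1 hj
      omega
    rw [baileyKernel, this, div_eq_mul_inv, mul_inv]
    ring

/-- One double series is summed in two ways: antidiagonals give the β-series, rows j > 0 give the
α-series, and row 0 gives the defect. -/
theorem tsum_betaWeight_of_summable_prod {a k w q : ℂ} (hq1 : ‖q‖ < 1) (hq : q ≠ 0)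
    (ha : a ≠ 0)
    (hk : ∀ i : ℕ, 1 - k * q ^ i ≠ 0) (haq : ∀ i : ℕ, 1 - a * q * q ^ i ≠ 0)
    (hkw : ∀ i : ℕ, 1 - k * w * q * q ^ i ≠ 0) (haw : ∀ i : ℕ, 1 - a * w * q * q ^ i ≠ 0)
    (hW : Summable fun m : ℕ => ‖revPoch w q m * (a * q) ^ m‖)
    {α β : ℕ → ℂ} (h : IsWPBaileyPair a k q α β)
    (hf : Summable fun p : ℕ × ℕ =>
      betaWeight a k w q (p.1 + p.2) * baileyKernel a k q p.1 p.2 * α p.1) :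
    ∑' n, betaWeight a k w q (n + 1) * β (n + 1) =
      ∑' n, alphaWeight a w q n * α (n + 1) - lambertDefect a k w q := by
  have hrow := hf.prod
  have hrows := hf.tsum_prod
  rw [hrow.tsum_eq_zero_add] at hrows
  simp only [zero_add, tsum_mul_right, tsum_betaWeight_mul_baileyKernel_succ hq1 hq ha hk haq hkw
    haw hW, tsum_betaWeight_mul_baileyKernel_zero hq1 ha hk haq hkw haw hW, h.1] at hrows
  have hsig := (Finset.HasAntidiagonal.sigmaAntidiagonalEquivProd (A := ℕ)).summable_iff.2 hf
  have hcol : ∀ n, ∑' p : Finset.HasAntidiagonal.antidiagonal n,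
      betaWeight a k w q ((p : ℕ × ℕ).1 + (p : ℕ × ℕ).2) *
        baileyKernel a k q (p : ℕ × ℕ).1 (p : ℕ × ℕ).2 * α (p : ℕ × ℕ).1 =
      betaWeight a k w q n * β n := fun n => by
    rw [h.eq_sum_antidiagonal, Finset.mul_sum]
    refine (Finset.tsum_subtype (Finset.HasAntidiagonal.antidiagonal n) (fun p : ℕ × ℕ =>
      betaWeight a k w q (p.1 + p.2) * baileyKernel a k q p.1 p.2 * α p.1)).trans ?_
    refine Finset.sum_congr rfl fun p hp => ?_
    rw [Finset.HasAntidiagonal.mem_antidiagonal.1 hp, mul_assoc]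
  have hcols : ∑' n, betaWeight a k w q n * β n = ∑' p : ℕ × ℕ,
      betaWeight a k w q (p.1 + p.2) * baileyKernel a k q p.1 p.2 * α p.1 := by
    rw [← (Finset.HasAntidiagonal.sigmaAntidiagonalEquivProd (A := ℕ)).tsum_eq]
    refine Eq.trans ?_ (hsig.tsum_sigma' fun n => (hasSum_fintype _).summable).symm
    exact tsum_congr fun n => (hcol n).symm
  have hsum : Summable fun n => betaWeight a k w q n * β n :=
    (hsig.sigma' fun n => (hasSum_fintype _).summable).congr hcol
  rw [hsum.tsum_eq_zero_add, hrows] at hcols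
  simp only [betaWeight, zero_mul, zero_add] at hcols ⊢
  rw [hcols]
  ring

/-! ### Analytic continuation in `w = 1 / z` -/

theorem revPoch_eq_zero_of_le {w q : ℂ} (hq : q ≠ 0) {M n : ℕ} (h : revPoch w q M = 0)
    (hn : M ≤ n) : revPoch w q n = 0 := by
  obtain ⟨m, rfl⟩ := Nat.exists_eq_add_of_le hn
  rw [revPoch_add _ _ _ _ hq, h, zero_mul]

theorem betaWeight_eq_zero {w q : ℂ} (a k : ℂ) {n : ℕ} (h : revPoch w q n = 0) :
    betaWeight a k w q n = 0 := by
  cases n with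
  | zero => rfl
  | succ n => simp [betaWeight, h]

theorem exists_pow_le_norm_revPoch {w q : ℂ} (hq1 : ‖q‖ < 1) (hw : w ≠ 0)
    (h : ∀ n, revPoch w q n ≠ 0) : ∃ C > 0, ∀ n, ‖w‖ ^ n ≤ C * ‖revPoch w q n‖ := by
  have e : ∀ n, revPoch w q n = qPoch w⁻¹ q n * w ^ n := fun n => by
    simpa using revPoch_eq (inv_ne_zero hw) q n
  have hz : ∀ i, 1 - w⁻¹ * q ^ i ≠ 0 := fun i => by
    have := h (i + 1)
    rw [e, qPoch_succ] at this
    exact right_ne_zero_of_mul (left_ne_zero_of_mul this)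
  obtain ⟨C, hC, b⟩ := exists_norm_inv_qPoch_le hq1 hz
  refine ⟨C, hC, fun n => ?_⟩
  have b' := b 0 n
  rw [pow_zero, mul_one] at b'
  calc ‖w‖ ^ n = ‖(qPoch w⁻¹ q n)⁻¹‖ * ‖revPoch w q n‖ := by
        rw [← norm_mul, e, inv_mul_cancel_left₀ (qPoch_ne_zero hz n), norm_pow]
    _ ≤ _ := by gcongr

/-- Both sides are compared with ‖w₀‖^n. Summability at the single point w₀ thereby yields a
majorant on the closed disc, as in Abel's lemma for power series. -/
theorem exists_norm_revPoch_le_norm_revPoch {w₀ q : ℂ} (hq1 : ‖q‖ < 1) (hw : w₀ ≠ 0)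
    (h : ∀ n, revPoch w₀ q n ≠ 0) :
    ∃ C > 0, ∀ w : ℂ, ‖w‖ ≤ ‖w₀‖ → ∀ n, ‖revPoch w q n‖ ≤ C * ‖revPoch w₀ q n‖ := by
  obtain ⟨C, hC, b⟩ := exists_norm_revPoch_le hq1 (norm_pos_iff.2 hw)
  obtain ⟨D, hD, b'⟩ := exists_pow_le_norm_revPoch hq1 hw h
  refine ⟨C * D, by positivity, fun w hw n => (b w hw n).trans ?_⟩
  rw [mul_assoc]
  gcongr
  exact b' n

/-- The series `∑ c n ∏ (w - q ^ i) / (x w q; q)_(n + 1)`, multiplied by `(x w q; q)_∞`. -/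
noncomputable def clearedSeries (x q : ℂ) (c : ℕ → ℂ) (w : ℂ) : ℂ :=
  ∑' n, c n * revPoch w q (n + 1) * qPochInf (x * w * q * q ^ (n + 1)) q

theorem clearedSeries_eq {x q w : ℂ} (hq1 : ‖q‖ < 1) (c : ℕ → ℂ)
    (hx : ∀ i : ℕ, 1 - x * w * q * q ^ i ≠ 0) :
    clearedSeries x q c w = qPochInf (x * w * q) q *
      ∑' n, c n * revPoch w q (n + 1) * (qPoch (x * w * q) q (n + 1))⁻¹ := by
  rw [clearedSeries, ← tsum_mul_left]
  refine tsum_congr fun n => ?_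
  have := qPoch_ne_zero hx (n + 1)
  rw [qPochInf_eq_mul hq1 (x * w * q) (n + 1)]
  field_simp

theorem differentiable_revPoch (q : ℂ) (n : ℕ) : Differentiable ℂ fun w => revPoch w q n := by
  unfold revPoch
  fun_prop

theorem exists_bound_clearedSeries {x q w₀ : ℂ} (hq1 : ‖q‖ < 1) (hw : w₀ ≠ 0)
    (h : ∀ n, revPoch w₀ q n ≠ 0) (hx : ∀ i : ℕ, 1 - x * w₀ * q * q ^ i ≠ 0) {c : ℕ → ℂ}
    (hc : Summable fun n => c n * revPoch w₀ q (n + 1) * (qPoch (x * w₀ * q) q (n + 1))⁻¹) :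
    ∃ u : ℕ → ℝ, Summable u ∧ ∀ n w, ‖w‖ ≤ ‖w₀‖ →
      ‖c n * revPoch w q (n + 1) * qPochInf (x * w * q * q ^ (n + 1)) q‖ ≤ u n := by
  obtain ⟨C, hC, b⟩ := exists_norm_revPoch_le_norm_revPoch hq1 hw h
  obtain ⟨D, hD, d⟩ := exists_norm_qPochInf_le hq1 (‖x‖ * ‖w₀‖ * ‖q‖)
  obtain ⟨B, hB, b'⟩ := exists_norm_qPoch_le hq1 ‖x * w₀ * q‖
  refine ⟨fun n => ‖c n * revPoch w₀ q (n + 1) * (qPoch (x * w₀ * q) q (n + 1))⁻¹‖ * (B * C * D),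
    hc.norm.mul_right _, fun n w hww => ?_⟩
  have e : ‖c n * revPoch w₀ q (n + 1)‖ ≤
      ‖c n * revPoch w₀ q (n + 1) * (qPoch (x * w₀ * q) q (n + 1))⁻¹‖ * B := by
    calc _ = ‖c n * revPoch w₀ q (n + 1) * (qPoch (x * w₀ * q) q (n + 1))⁻¹‖ *
          ‖qPoch (x * w₀ * q) q (n + 1)‖ := by
          rw [← norm_mul, inv_mul_cancel_right₀ (qPoch_ne_zero hx (n + 1))]
      _ ≤ _ := by gcongr; exact b' _ le_rfl _
  calc _ = ‖c n‖ * ‖revPoch w q (n + 1)‖ * ‖qPochInf (x * w * q * q ^ (n + 1)) q‖ := by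
        rw [norm_mul, norm_mul]
    _ ≤ ‖c n‖ * (C * ‖revPoch w₀ q (n + 1)‖) * D := by
        gcongr
        · exact b w hww _
        · refine d _ ((norm_mul_pow_le hq1 _ _).trans ?_)
          rw [norm_mul, norm_mul]
          gcongr
    _ = ‖c n * revPoch w₀ q (n + 1)‖ * (C * D) := by rw [norm_mul]; ring
    _ ≤ _ := by
        refine (mul_le_mul_of_nonneg_right e (by positivity)).trans_eq ?_
        ring

/-- The M-test applies on the closed disc; continuity at the boundary matters because w₀ lies on it.
-/
theorem diffContOnCl_clearedSeries {x q w₀ : ℂ} (hq1 : ‖q‖ < 1) (hw : w₀ ≠ 0)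
    (h : ∀ n, revPoch w₀ q n ≠ 0) (hx : ∀ i : ℕ, 1 - x * w₀ * q * q ^ i ≠ 0) {c : ℕ → ℂ}
    (hc : Summable fun n => c n * revPoch w₀ q (n + 1) * (qPoch (x * w₀ * q) q (n + 1))⁻¹) :
    DiffContOnCl ℂ (clearedSeries x q c) (Metric.ball 0 ‖w₀‖) := by
  obtain ⟨u, hu, b⟩ := exists_bound_clearedSeries hq1 hw h hx hc
  have hd : ∀ n, Differentiable ℂ fun w =>
      c n * revPoch w q (n + 1) * qPochInf (x * w * q * q ^ (n + 1)) q := fun n =>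
    ((differentiable_revPoch q (n + 1)).const_mul (c n)).mul
      ((differentiable_qPochInf hq1).comp (by fun_prop))
  refine ⟨Complex.differentiableOn_tsum_of_summable_norm hu (fun n => (hd n).differentiableOn)
    Metric.isOpen_ball fun n w hw => b n w (mem_ball_zero_iff.1 hw).le, ?_⟩
  rw [closure_ball _ (norm_ne_zero_iff.2 hw)]
  exact continuousOn_tsum (fun n => (hd n).continuous.continuousOn) hu
    fun n w hw => b n w (mem_closedBall_zero_iff.1 hw)

/-- The identity theorem in the open disc, then continuity up to w₀. -/
theorem DiffContOnCl.eq_zero_of_eventually {f : ℂ → ℂ} {w₀ : ℂ} (hw : w₀ ≠ 0)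
    (hf : DiffContOnCl ℂ f (Metric.ball 0 ‖w₀‖)) (h0 : ∀ᶠ w in 𝓝 0, f w = 0) : f w₀ = 0 := by
  have hpos := norm_pos_iff.2 hw
  have h1 : Set.EqOn f 0 (Metric.ball 0 ‖w₀‖) :=
    (hf.differentiableOn.analyticOnNhd Metric.isOpen_ball).eqOn_zero_of_preconnected_of_eventuallyEq_zero
      (convex_ball _ _).isPreconnected (Metric.mem_ball_self hpos) h0
  have h2 := h1.of_subset_closure hf.continuousOn continuousOn_const subset_closure subset_rfl
  refine h2 ?_
  rw [closure_ball _ hpos.ne']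
  simp

/-- The coefficients of the `β`-weighted series with respect to `∏ (w - q ^ i) / (k w q; q)_n`. -/
noncomputable def betaCoeff (a k q : ℂ) (β : ℕ → ℂ) (n : ℕ) : ℂ :=
  (1 - k * q ^ (2 * (n + 1))) * qPoch q q n * (1 - k)⁻¹ * (qPoch (k * q) q (n + 1))⁻¹ *
    (a * q) ^ (n + 1) * β (n + 1)

/-- The coefficients of the `α`-weighted series with respect to `∏ (w - q ^ i) / (a w q; q)_n`. -/
noncomputable def alphaCoeff (a q : ℂ) (α : ℕ → ℂ) (n : ℕ) : ℂ :=
  qPoch q q n * (qPoch (a * q) q (n + 1))⁻¹ * (a * q) ^ (n + 1) * α (n + 1)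

theorem betaWeight_mul_eq (a k w q : ℂ) (β : ℕ → ℂ) (n : ℕ) :
    betaWeight a k w q (n + 1) * β (n + 1) =
      betaCoeff a k q β n * revPoch w q (n + 1) * (qPoch (k * w * q) q (n + 1))⁻¹ := by
  rw [betaWeight, betaCoeff]; ring

theorem alphaWeight_mul_eq (a w q : ℂ) (α : ℕ → ℂ) (n : ℕ) :
    alphaWeight a w q n * α (n + 1) =
      alphaCoeff a q α n * revPoch w q (n + 1) * (qPoch (a * w * q) q (n + 1))⁻¹ := by
  rw [alphaWeight, alphaCoeff]; ring

/-- The difference of the two sides of the transformation, multiplied by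
`(k w q; q)_∞ (a w q; q)_∞`. -/
noncomputable def clearedDefect (a k q : ℂ) (α β : ℕ → ℂ) (w : ℂ) : ℂ :=
  qPochInf (a * w * q) q * clearedSeries k q (betaCoeff a k q β) w -
    qPochInf (k * w * q) q * clearedSeries a q (alphaCoeff a q α) w +
    (-(k * w * q) * deriv (fun y => qPochInf y q) (k * w * q) * qPochInf (a * w * q) q +
      a * w * q * deriv (fun y => qPochInf y q) (a * w * q) * qPochInf (k * w * q) q +
      qPochInf (k * w * q) q * qPochInf (a * w * q) q *
        (lambert (a * q) q - lambert (k * q) q))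

theorem clearedDefect_eq {a k q w : ℂ} (hq1 : ‖q‖ < 1) (α β : ℕ → ℂ)
    (hkw : ∀ i : ℕ, 1 - k * w * q * q ^ i ≠ 0) (haw : ∀ i : ℕ, 1 - a * w * q * q ^ i ≠ 0) :
    clearedDefect a k q α β w = qPochInf (k * w * q) q * qPochInf (a * w * q) q *
      (∑' n, betaWeight a k w q (n + 1) * β (n + 1) -
        (∑' n, alphaWeight a w q n * α (n + 1) - lambertDefect a k w q)) := by
  simp only [betaWeight_mul_eq, alphaWeight_mul_eq]
  rw [clearedDefect, clearedSeries_eq hq1 _ hkw, clearedSeries_eq hq1 _ haw,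
    neg_mul_deriv_qPochInf hq1 hkw, lambertDefect]
  linear_combination -qPochInf (k * w * q) q * neg_mul_deriv_qPochInf hq1 haw

theorem diffContOnCl_clearedDefect {a k q w₀ : ℂ} (hq1 : ‖q‖ < 1) (hw : w₀ ≠ 0)
    (h : ∀ n, revPoch w₀ q n ≠ 0)
    (hkw : ∀ i : ℕ, 1 - k * w₀ * q * q ^ i ≠ 0) (haw : ∀ i : ℕ, 1 - a * w₀ * q * q ^ i ≠ 0)
    {α β : ℕ → ℂ} (hβ : Summable fun n => betaWeight a k w₀ q (n + 1) * β (n + 1))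
    (hα : Summable fun n => alphaWeight a w₀ q n * α (n + 1)) :
    DiffContOnCl ℂ (clearedDefect a k q α β) (Metric.ball 0 ‖w₀‖) := by
  simp only [betaWeight_mul_eq] at hβ
  simp only [alphaWeight_mul_eq] at hα
  have sβ := diffContOnCl_clearedSeries hq1 hw h hkw hβ
  have sα := diffContOnCl_clearedSeries hq1 hw h haw hα
  have hP : ∀ x : ℂ, Differentiable ℂ fun w => qPochInf (x * w * q) q := fun x =>
    (differentiable_qPochInf hq1).comp (by fun_prop)
  have hP' : Differentiable ℂ (deriv fun y => qPochInf y q) := by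
    have := (differentiable_qPochInf hq1).differentiableOn.deriv isOpen_univ
    exact differentiableOn_univ.1 this
  have hD : ∀ x : ℂ, Differentiable ℂ fun w => deriv (fun y => qPochInf y q) (x * w * q) :=
    fun x => hP'.comp (by fun_prop)
  have hrest : Differentiable ℂ fun w =>
      -(k * w * q) * deriv (fun y => qPochInf y q) (k * w * q) * qPochInf (a * w * q) q +
      a * w * q * deriv (fun y => qPochInf y q) (a * w * q) * qPochInf (k * w * q) q +
      qPochInf (k * w * q) q * qPochInf (a * w * q) q *
        (lambert (a * q) q - lambert (k * q) q) := by
    have h1 := hP a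
    have h2 := hP k
    have h3 := hD a
    have h4 := hD k
    exact ((((by fun_prop : Differentiable ℂ fun w : ℂ => -(k * w * q)).mul h4).mul h1).add
      (((by fun_prop : Differentiable ℂ fun w : ℂ => a * w * q).mul h3).mul h2)).add
      ((h2.mul h1).mul_const _)
  exact (((hP a).diffContOnCl.smul sβ).sub ((hP k).diffContOnCl.smul sα)).add hrest.diffContOnCl

/-! ### Absolute convergence of the double series for small w -/

/-- The terms of the convergent α-series at w₀ are bounded, and its weights are bounded below by a
multiple of (‖aq‖‖w₀‖)^j. -/
theorem exists_norm_alpha_mul_pow_le {a q w₀ : ℂ} (hq1 : ‖q‖ < 1)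
    (hw : w₀ ≠ 0) (h : ∀ n, revPoch w₀ q n ≠ 0) (haq : ∀ i : ℕ, 1 - a * q * q ^ i ≠ 0)
    (haw : ∀ i : ℕ, 1 - a * w₀ * q * q ^ i ≠ 0) {α : ℕ → ℂ}
    (hα : Summable fun n => alphaWeight a w₀ q n * α (n + 1)) :
    ∃ D > 0, ∀ j, ‖α j‖ * (‖a * q‖ * ‖w₀‖) ^ j ≤ D := by
  obtain ⟨A, hA⟩ := hα.tendsto_atTop_zero.norm.bddAbove_range
  obtain ⟨C1, hC1, b1⟩ := exists_pow_le_norm_revPoch hq1 hw h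
  obtain ⟨C2, hC2, b2⟩ := exists_norm_qPoch_le hq1 ‖a * q‖
  obtain ⟨C3, hC3, b3⟩ := exists_norm_qPoch_le hq1 ‖a * w₀ * q‖
  obtain ⟨C4, hC4, b4⟩ := exists_norm_inv_qPoch_le hq1 (one_sub_pow_ne_zero hq1)
  have hA0 : ∀ n, ‖alphaWeight a w₀ q n * α (n + 1)‖ ≤ A := fun n => hA ⟨n, rfl⟩
  have hAnn : 0 ≤ A := (norm_nonneg _).trans (hA0 0)
  refine ⟨A * C1 * C2 * C3 * C4 + ‖α 0‖ + 1, by positivity, fun j => ?_⟩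
  cases j with
  | zero =>
    rw [pow_zero, mul_one]
    have : 0 ≤ A * C1 * C2 * C3 * C4 := by positivity
    linarith
  | succ n =>
    have e : ‖α (n + 1)‖ * ‖a * q‖ ^ (n + 1) * ‖revPoch w₀ q (n + 1)‖ =
        ‖alphaWeight a w₀ q n * α (n + 1)‖ * ‖qPoch (a * q) q (n + 1)‖ *
          ‖qPoch (a * w₀ * q) q (n + 1)‖ * ‖(qPoch q q n)⁻¹‖ := by
      have p1 := qPoch_ne_zero haq (n + 1)
      have p2 := qPoch_ne_zero haw (n + 1)
      have p3 := qPoch_ne_zero (one_sub_pow_ne_zero hq1) n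
      rw [← norm_pow, ← norm_mul, ← norm_mul, ← norm_mul, ← norm_mul, ← norm_mul, alphaWeight]
      congr 1
      generalize (a * q) ^ (n + 1) = x
      generalize qPoch (a * q) q (n + 1) = P1 at *
      field_simp
    have b4' := b4 0 n
    rw [pow_zero, mul_one] at b4'
    have h5 : ‖α (n + 1)‖ * (‖a * q‖ * ‖w₀‖) ^ (n + 1) ≤ A * C1 * C2 * C3 * C4 :=
      calc _ = ‖α (n + 1)‖ * ‖a * q‖ ^ (n + 1) * ‖w₀‖ ^ (n + 1) := by rw [mul_pow, mul_assoc]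
        _ ≤ ‖α (n + 1)‖ * ‖a * q‖ ^ (n + 1) * (C1 * ‖revPoch w₀ q (n + 1)‖) := by
            gcongr; exact b1 _
        _ = C1 * (‖alphaWeight a w₀ q n * α (n + 1)‖ * ‖qPoch (a * q) q (n + 1)‖ *
          ‖qPoch (a * w₀ * q) q (n + 1)‖ * ‖(qPoch q q n)⁻¹‖) := by rw [← e]; ring
        _ ≤ C1 * (A * C2 * C3 * C4) := by
            gcongr
            · exact hA0 n
            · exact b2 _ le_rfl _
            · exact b3 _ le_rfl _
        _ = _ := by ring
    linarith [norm_nonneg (α 0)]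

theorem exists_norm_betaWeight_le {a k w q : ℂ} (hq1 : ‖q‖ < 1) {r : ℝ} (hr : 0 < r)
    (hw : ‖w‖ ≤ r) (hkq : ∀ i : ℕ, 1 - k * q * q ^ i ≠ 0)
    (hkw : ∀ i : ℕ, 1 - k * w * q * q ^ i ≠ 0) :
    ∃ C > 0, ∀ n, ‖betaWeight a k w q n‖ ≤ C * (r * ‖a * q‖) ^ n := by
  obtain ⟨C1, hC1, b1⟩ := exists_norm_revPoch_le hq1 hr
  obtain ⟨C2, hC2, b2⟩ := exists_norm_qPoch_le hq1 ‖q‖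
  obtain ⟨C3, hC3, b3⟩ := exists_norm_inv_qPoch_le hq1 hkq
  obtain ⟨C4, hC4, b4⟩ := exists_norm_inv_qPoch_le hq1 hkw
  -- The added 1 only keeps the constant visibly positive.
  refine ⟨(1 + ‖k‖) * C1 * C2 * (‖(1 - k)⁻¹‖ + 1) * C3 * C4, by positivity, fun n => ?_⟩
  cases n with
  | zero => simp only [betaWeight, norm_zero]; positivity
  | succ n =>
    have b3' := b3 0 (n + 1)
    have b4' := b4 0 (n + 1)
    rw [pow_zero, mul_one] at b3' b4'
    rw [betaWeight]
    simp only [norm_mul (_ * _) _, norm_mul (1 - k * q ^ (2 * (n + 1))), norm_pow]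
    calc _ ≤ (1 + ‖k‖) * (C1 * r ^ (n + 1)) * C2 * (‖(1 - k)⁻¹‖ + 1) * C3 * C4 *
          ‖a * q‖ ^ (n + 1) := by
          rw [norm_mul a q]
          gcongr
          · exact norm_one_sub_mul_pow_le hq1 _ _
          · exact b1 w hw _
          · exact b2 _ le_rfl _
          · linarith
      _ = _ := by rw [mul_pow]; ring

theorem exists_norm_baileyKernel_le {a k q : ℂ} (hq1 : ‖q‖ < 1)
    (haq : ∀ i : ℕ, 1 - a * q * q ^ i ≠ 0) :
    ∃ C > 0, ∀ j m, ‖baileyKernel a k q j m‖ ≤ C := by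
  obtain ⟨C1, hC1, b1⟩ := exists_norm_qPoch_le hq1 ‖k / a‖
  obtain ⟨C2, hC2, b2⟩ := exists_norm_qPoch_le hq1 ‖k‖
  obtain ⟨C3, hC3, b3⟩ := exists_norm_inv_qPoch_le hq1 (one_sub_pow_ne_zero hq1)
  obtain ⟨C4, hC4, b4⟩ := exists_norm_inv_qPoch_le hq1 haq
  refine ⟨C1 * C2 * C3 * C4, by positivity, fun j m => ?_⟩
  have b3' := b3 0 m
  have b4' := b4 0 (2 * j + m)
  rw [pow_zero, mul_one] at b3' b4'
  rw [baileyKernel, norm_mul, norm_mul, norm_mul]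
  gcongr
  · exact b1 _ le_rfl _
  · exact b2 _ le_rfl _

theorem one_sub_ne_zero_of_norm_lt {x q w : ℂ} (hq1 : ‖q‖ < 1) (h : ‖x‖ * ‖w‖ < 1) (i : ℕ) :
    1 - x * w * q * q ^ i ≠ 0 := by
  intro h0
  have h1 : ‖x * w * q ^ (i + 1)‖ = 1 := by
    rw [pow_succ', ← mul_assoc, ← sub_eq_zero.1 h0, norm_one]
  have := norm_mul_pow_le hq1 (x * w) (i + 1)
  rw [h1, norm_mul] at this
  linarith

theorem tsum_betaWeight_of_small {a k w w₀ q : ℂ} (hq1 : ‖q‖ < 1) (hq : q ≠ 0) (ha : a ≠ 0)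
    (hk : ∀ i : ℕ, 1 - k * q ^ i ≠ 0) (haq : ∀ i : ℕ, 1 - a * q * q ^ i ≠ 0)
    (hkw : ∀ i : ℕ, 1 - k * w * q * q ^ i ≠ 0) (haw : ∀ i : ℕ, 1 - a * w * q * q ^ i ≠ 0)
    {r : ℝ} (hr : 0 < r) (hwr : ‖w‖ ≤ r) (hr1 : r * ‖a * q‖ ≤ 1 / 2) (hr2 : r ≤ ‖w₀‖ / 2)
    {α β : ℕ → ℂ} (h : IsWPBaileyPair a k q α β) {D : ℝ}
    (hα : ∀ j, ‖α j‖ * (‖a * q‖ * ‖w₀‖) ^ j ≤ D) :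
    ∑' n, betaWeight a k w q (n + 1) * β (n + 1) =
      ∑' n, alphaWeight a w q n * α (n + 1) - lambertDefect a k w q := by
  have hkq : ∀ i : ℕ, 1 - k * q * q ^ i ≠ 0 := fun i => by
    simpa only [pow_one] using one_sub_shift_ne_zero hk 1 i
  have hgeo := summable_geometric_of_lt_one (r := (1 / 2 : ℝ)) (by norm_num) (by norm_num)
  refine tsum_betaWeight_of_summable_prod hq1 hq ha hk haq hkw haw ?_ h ?_
  · obtain ⟨C, hC, b⟩ := exists_norm_revPoch_le hq1 hr
    refine Summable.of_nonneg_of_le (fun _ => norm_nonneg _) (fun m => ?_) (hgeo.mul_left C)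
    calc _ = ‖revPoch w q m‖ * ‖a * q‖ ^ m := by rw [norm_mul, norm_pow]
      _ ≤ C * r ^ m * ‖a * q‖ ^ m := by gcongr; exact b w hwr m
      _ = C * (r * ‖a * q‖) ^ m := by rw [mul_pow, mul_assoc]
      _ ≤ _ := by gcongr
  · obtain ⟨C1, hC1, b1⟩ := exists_norm_betaWeight_le (a := a) hq1 hr hwr hkq hkw
    obtain ⟨C2, hC2, b2⟩ := exists_norm_baileyKernel_le (k := k) hq1 haq
    have hprod := (hgeo.mul_of_nonneg hgeo (fun _ => by positivity) fun _ => by positivity).mul_left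
      (C1 * C2 * D)
    refine Summable.of_norm_bounded hprod fun p => ?_
    -- In the j-direction half of ‖w₀‖ is given up to offset the growth of α; in the m-direction
    -- `hr1` suffices.
    have hj : (r * ‖a * q‖) ^ p.1 ≤ (1 / 2) ^ p.1 * (‖a * q‖ * ‖w₀‖) ^ p.1 := by
      rw [← mul_pow]
      have := mul_le_mul_of_nonneg_right hr2 (norm_nonneg (a * q))
      exact pow_le_pow_left₀ (by positivity) (by linarith) _
    have hm : (r * ‖a * q‖) ^ p.2 ≤ (1 / 2) ^ p.2 := by gcongr
    calc _ = ‖betaWeight a k w q (p.1 + p.2)‖ * ‖baileyKernel a k q p.1 p.2‖ * ‖α p.1‖ := by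
          rw [norm_mul, norm_mul]
      _ ≤ C1 * (r * ‖a * q‖) ^ (p.1 + p.2) * C2 * ‖α p.1‖ := by
          gcongr
          · exact b1 _
          · exact b2 _ _
      _ = C1 * C2 * ‖α p.1‖ * ((r * ‖a * q‖) ^ p.1 * (r * ‖a * q‖) ^ p.2) := by
          rw [pow_add]; ring
      _ ≤ C1 * C2 * ‖α p.1‖ * ((1 / 2) ^ p.1 * (‖a * q‖ * ‖w₀‖) ^ p.1 * (1 / 2) ^ p.2) := by
          gcongr
      _ = C1 * C2 * (‖α p.1‖ * (‖a * q‖ * ‖w₀‖) ^ p.1) * ((1 / 2) ^ p.1 * (1 / 2) ^ p.2) := by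
          ring
      _ ≤ _ := by
          gcongr
          exact hα _

/-- The limiting `WP`-Bailey transformation, in terms of `w = 1 / z`. -/
theorem tsum_betaWeight_eq {a k w q : ℂ} (hq1 : ‖q‖ < 1) (hq : q ≠ 0) (ha : a ≠ 0) (hw : w ≠ 0)
    (hk : ∀ i : ℕ, 1 - k * q ^ i ≠ 0) (haq : ∀ i : ℕ, 1 - a * q * q ^ i ≠ 0)
    (hkw : ∀ i : ℕ, 1 - k * w * q * q ^ i ≠ 0) (haw : ∀ i : ℕ, 1 - a * w * q * q ^ i ≠ 0)
    {α β : ℕ → ℂ} (h : IsWPBaileyPair a k q α β)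
    (hβ : Summable fun n => betaWeight a k w q (n + 1) * β (n + 1))
    (hα : Summable fun n => alphaWeight a w q n * α (n + 1)) :
    ∑' n, betaWeight a k w q (n + 1) * β (n + 1) =
      ∑' n, alphaWeight a w q n * α (n + 1) - lambertDefect a k w q := by
  -- If w is a power of q, the double series has finite support; otherwise the comparison with ‖w‖^n
  -- is available and continuation applies.
  by_cases hM : ∃ M, revPoch w q M = 0
  · obtain ⟨M, hM⟩ := hM
    refine tsum_betaWeight_of_summable_prod hq1 hq ha hk haq hkw haw ?_ h ?_
    · refine summable_of_ne_finset_zero (s := Finset.range M) fun m hm => ?_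
      rw [revPoch_eq_zero_of_le hq hM (by simpa using hm), zero_mul, norm_zero]
    · refine summable_of_ne_finset_zero (s := Finset.range M ×ˢ Finset.range M) fun p hp => ?_
      have : M ≤ p.1 + p.2 := by
        simp only [Finset.mem_product, Finset.mem_range] at hp
        omega
      rw [betaWeight_eq_zero _ _ (revPoch_eq_zero_of_le hq hM this), zero_mul, zero_mul]
  · replace hM : ∀ n, revPoch w q n ≠ 0 := not_exists.1 hM
    obtain ⟨D, -, hαD⟩ := exists_norm_alpha_mul_pow_le hq1 hw hM haq haw hα
    have hE := diffContOnCl_clearedDefect hq1 hw hM hkw haw hβ hα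
    have hwpos := norm_pos_iff.2 hw
    -- The first two conditions give absolute convergence; the last two keep the denominators
    -- nonzero on the small disc.
    have small : ∀ᶠ r : ℝ in 𝓝[>] 0, r * ‖a * q‖ ≤ 1 / 2 ∧ r ≤ ‖w‖ / 2 ∧ ‖k‖ * r < 1 ∧
        ‖a‖ * r < 1 := by
      have t1 : Tendsto (fun r : ℝ => r * ‖a * q‖) (𝓝[>] 0) (𝓝 0) :=
        ((continuous_id.mul continuous_const).tendsto' (0 : ℝ) 0 (by simp)).mono_left
          nhdsWithin_le_nhds
      have t2 : Tendsto (fun r : ℝ => r) (𝓝[>] 0) (𝓝 0) := tendsto_id.mono_left nhdsWithin_le_nhds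
      have t3 : ∀ x : ℝ, Tendsto (fun r : ℝ => x * r) (𝓝[>] 0) (𝓝 0) := fun x =>
        ((continuous_const.mul continuous_id).tendsto' (0 : ℝ) 0 (by simp)).mono_left
          nhdsWithin_le_nhds
      filter_upwards [t1.eventually_le_const (by norm_num : (0 : ℝ) < 1 / 2),
        t2.eventually_le_const (half_pos hwpos), (t3 ‖k‖).eventually_lt_const one_pos,
        (t3 ‖a‖).eventually_lt_const one_pos] with r h1 h2 h3 h4
      exact ⟨h1, h2, h3, h4⟩
    obtain ⟨r, ⟨hr1, hr2, hr3, hr4⟩, hr⟩ := (small.and self_mem_nhdsWithin).exists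
    have hr0 : 0 < r := hr
    have hev : ∀ᶠ x in 𝓝 0, clearedDefect a k q α β x = 0 := by
      filter_upwards [Metric.ball_mem_nhds (0 : ℂ) hr0] with x hx
      have hxr : ‖x‖ ≤ r := (mem_ball_zero_iff.1 hx).le
      have hkx : ∀ i : ℕ, 1 - k * x * q * q ^ i ≠ 0 := one_sub_ne_zero_of_norm_lt hq1
        ((mul_le_mul_of_nonneg_left hxr (norm_nonneg k)).trans_lt hr3)
      have hax : ∀ i : ℕ, 1 - a * x * q * q ^ i ≠ 0 := one_sub_ne_zero_of_norm_lt hq1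
        ((mul_le_mul_of_nonneg_left hxr (norm_nonneg a)).trans_lt hr4)
      rw [clearedDefect_eq hq1 α β hkx hax,
        tsum_betaWeight_of_small hq1 hq ha hk haq hkx hax hr0 hxr hr1 hr2 h hαD, sub_self,
        mul_zero]
    have hz := hE.eq_zero_of_eventually hw hev
    rw [clearedDefect_eq hq1 α β hkw haw] at hz
    exact sub_eq_zero.1 ((mul_eq_zero.1 hz).resolve_left
      (mul_ne_zero (qPochInf_ne_zero hq1 hkw) (qPochInf_ne_zero hq1 haw)))

/-! ### The theorem -/

theorem betaTerm_eq {z : ℂ} (hz : z ≠ 0) (a k q : ℂ) (β : ℕ → ℂ) (n : ℕ) :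
    betaTerm a k z q β (n + 1) = betaWeight a k z⁻¹ q (n + 1) * β (n + 1) := by
  rw [betaTerm, betaWeight, revPoch_eq hz, Nat.add_sub_cancel, mul_comm q k, mul_comm q a,
    show k * q / z = k * z⁻¹ * q by ring, div_pow, inv_pow]
  simp only [div_eq_mul_inv, mul_inv]
  ring

theorem alphaTerm_eq {z : ℂ} (hz : z ≠ 0) (a q : ℂ) (α : ℕ → ℂ) (n : ℕ) :
    alphaTerm a z q α (n + 1) = alphaWeight a z⁻¹ q n * α (n + 1) := by
  rw [alphaTerm, alphaWeight, revPoch_eq hz, Nat.add_sub_cancel, mul_comm q a,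
    show a * q / z = a * z⁻¹ * q by ring, show a * z⁻¹ * q = a * q * z⁻¹ by ring, mul_pow]
  simp only [div_eq_mul_inv, mul_inv]
  ring

/-- The limiting `WP`-Bailey transformation. -/
theorem tsum_betaTerm_eq {a k z q : ℂ} (hq1 : ‖q‖ < 1) (hq : q ≠ 0) (ha : a ≠ 0) (hz : z ≠ 0)
    (hk : ∀ i : ℕ, 1 - k * q ^ i ≠ 0) (haq : ∀ n : ℕ, 1 ≤ n → 1 - a * q ^ n ≠ 0)
    (hkz : ∀ n : ℕ, 1 ≤ n → 1 - k / z * q ^ n ≠ 0) (haz : ∀ n : ℕ, 1 ≤ n → 1 - a / z * q ^ n ≠ 0)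
    {α β : ℕ → ℂ} (h : IsWPBaileyPair a k q α β)
    (hβ : Summable fun n => betaTerm a k z q β (n + 1))
    (hα : Summable fun n => alphaTerm a z q α (n + 1)) :
    ∑' n, betaTerm a k z q β (n + 1) =
      ∑' n, alphaTerm a z q α (n + 1) - lambertDefect a k z⁻¹ q := by
  simp only [betaTerm_eq hz] at hβ ⊢
  simp only [alphaTerm_eq hz] at hα ⊢
  have shift : ∀ x : ℂ, (∀ n : ℕ, 1 ≤ n → 1 - x * q ^ n ≠ 0) → ∀ i : ℕ, 1 - x * q * q ^ i ≠ 0 :=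
    fun x hx i => by simpa only [pow_succ', mul_assoc] using hx (i + 1) (Nat.le_add_left 1 i)
  exact tsum_betaWeight_eq hq1 hq ha (inv_ne_zero hz) hk (shift a haq) (shift _ hkz) (shift _ haz)
    h hβ hα

theorem lambertDefect_add_neg {a k w q : ℂ} (hq1 : ‖q‖ < 1)
    (hk : ∀ i : ℕ, 1 - k * q * q ^ i ≠ 0 ∧ 1 + k * q * q ^ i ≠ 0)
    (haq : ∀ i : ℕ, 1 - a * q * q ^ i ≠ 0 ∧ 1 + a * q * q ^ i ≠ 0)
    (hkw : ∀ i : ℕ, 1 - k * w * q * q ^ i ≠ 0 ∧ 1 + k * w * q * q ^ i ≠ 0)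
    (haw : ∀ i : ℕ, 1 - a * w * q * q ^ i ≠ 0 ∧ 1 + a * w * q * q ^ i ≠ 0) :
    lambertDefect a k w q + lambertDefect (-a) (-k) w q =
      2 * lambertDefect (a ^ 2) (k ^ 2) (w ^ 2) (q ^ 2) := by
  simp only [lambertDefect, neg_mul, ← mul_pow]
  linear_combination lambert_add_lambert_neg hq1 hkw + lambert_add_lambert_neg hq1 haq -
    lambert_add_lambert_neg hq1 hk - lambert_add_lambert_neg hq1 haw

theorem theorem2
    (a k z q : ℂ) (hq : ‖q‖ < 1) (ha : a ≠ 0) (hz : z ≠ 0)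
    -- none of the denominators vanishes
    (hk : ∀ n : ℕ, 1 - k * q ^ n ≠ 0 ∧ 1 + k * q ^ n ≠ 0)
    (haq : ∀ n : ℕ, 1 ≤ n → 1 - a * q ^ n ≠ 0 ∧ 1 + a * q ^ n ≠ 0)
    (hkz : ∀ n : ℕ, 1 ≤ n → 1 - k / z * q ^ n ≠ 0 ∧ 1 + k / z * q ^ n ≠ 0)
    (haz : ∀ n : ℕ, 1 ≤ n → 1 - a / z * q ^ n ≠ 0 ∧ 1 + a / z * q ^ n ≠ 0)
    -- `α a k q n` stands for `α_n(a, k, q)`, and similarly for `β`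
    (α β : ℂ → ℂ → ℂ → ℕ → ℂ)
    (h₁ : IsWPBaileyPair a k q (α a k q) (β a k q))
    (h₂ : IsWPBaileyPair (-a) (-k) q (α (-a) (-k) q) (β (-a) (-k) q))
    (h₃ : IsWPBaileyPair (a ^ 2) (k ^ 2) (q ^ 2)
      (α (a ^ 2) (k ^ 2) (q ^ 2)) (β (a ^ 2) (k ^ 2) (q ^ 2)))
    -- each of the six series converges
    (hβ₁ : Summable fun n : ℕ => betaTerm a k z q (β a k q) (n + 1))
    (hβ₂ : Summable fun n : ℕ => betaTerm (-a) (-k) z q (β (-a) (-k) q) (n + 1))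
    (hβ₃ : Summable fun n : ℕ =>
      betaTerm (a ^ 2) (k ^ 2) (z ^ 2) (q ^ 2) (β (a ^ 2) (k ^ 2) (q ^ 2)) (n + 1))
    (hα₁ : Summable fun n : ℕ => alphaTerm a z q (α a k q) (n + 1))
    (hα₂ : Summable fun n : ℕ => alphaTerm (-a) z q (α (-a) (-k) q) (n + 1))
    (hα₃ : Summable fun n : ℕ =>
      alphaTerm (a ^ 2) (z ^ 2) (q ^ 2) (α (a ^ 2) (k ^ 2) (q ^ 2)) (n + 1)) :
    (∑' n : ℕ, betaTerm a k z q (β a k q) (n + 1))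
      + (∑' n : ℕ, betaTerm (-a) (-k) z q (β (-a) (-k) q) (n + 1))
      - 2 * (∑' n : ℕ,
          betaTerm (a ^ 2) (k ^ 2) (z ^ 2) (q ^ 2) (β (a ^ 2) (k ^ 2) (q ^ 2)) (n + 1))
    = (∑' n : ℕ, alphaTerm a z q (α a k q) (n + 1))
      + (∑' n : ℕ, alphaTerm (-a) z q (α (-a) (-k) q) (n + 1))
      - 2 * (∑' n : ℕ,
          alphaTerm (a ^ 2) (z ^ 2) (q ^ 2) (α (a ^ 2) (k ^ 2) (q ^ 2)) (n + 1)) := by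
  -- For q = 0 every term contains a positive power of 0; the general argument divides by powers of
  -- q.
  rcases eq_or_ne q 0 with rfl | hq0
  · simp [betaTerm, alphaTerm]
  have sq : ∀ x : ℂ, ∀ n : ℕ, 1 - x * q ^ n ≠ 0 ∧ 1 + x * q ^ n ≠ 0 →
      1 - x ^ 2 * (q ^ 2) ^ n ≠ 0 := fun x n hx => by
    rw [show 1 - x ^ 2 * (q ^ 2) ^ n = (1 - x * q ^ n) * (1 + x * q ^ n) by ring]
    exact mul_ne_zero hx.1 hx.2
  have ng : ∀ x : ℂ, ∀ n : ℕ, 1 - x * q ^ n ≠ 0 ∧ 1 + x * q ^ n ≠ 0 → 1 - -x * q ^ n ≠ 0 :=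
    fun x n hx => by simpa using hx.2
  have shift : ∀ x : ℂ, (∀ n : ℕ, 1 ≤ n → 1 - x * q ^ n ≠ 0 ∧ 1 + x * q ^ n ≠ 0) →
      ∀ i : ℕ, 1 - x * q * q ^ i ≠ 0 ∧ 1 + x * q * q ^ i ≠ 0 :=
    fun x hx i => by simpa only [pow_succ', mul_assoc] using hx (i + 1) (Nat.le_add_left 1 i)
  have hq2 : ‖q ^ 2‖ < 1 := by
    rw [norm_pow]; exact pow_lt_one₀ (norm_nonneg q) hq two_ne_zero
  have e₁ := tsum_betaTerm_eq hq hq0 ha hz (fun n => (hk n).1) (fun n hn => (haq n hn).1)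
    (fun n hn => (hkz n hn).1) (fun n hn => (haz n hn).1) h₁ hβ₁ hα₁
  have e₂ := tsum_betaTerm_eq hq hq0 (neg_ne_zero.2 ha) hz (fun n => ng k n (hk n))
    (fun n hn => ng a n (haq n hn)) (fun n hn => by rw [neg_div]; exact ng _ n (hkz n hn))
    (fun n hn => by rw [neg_div]; exact ng _ n (haz n hn)) h₂ hβ₂ hα₂
  have e₃ := tsum_betaTerm_eq hq2 (pow_ne_zero 2 hq0) (pow_ne_zero 2 ha) (pow_ne_zero 2 hz)
    (fun n => sq k n (hk n))
    (fun n hn => sq a n (haq n hn)) (fun n hn => by rw [← div_pow]; exact sq _ n (hkz n hn))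
    (fun n hn => by rw [← div_pow]; exact sq _ n (haz n hn)) h₃ hβ₃ hα₃
  have e₄ := lambertDefect_add_neg hq (shift k fun n _ => hk n) (shift a haq)
    (shift (k * z⁻¹) hkz) (shift (a * z⁻¹) haz)
  rw [inv_pow] at e₄
  rw [e₁, e₂, e₃]
  linear_combination -e₄
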